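/- Let $F$ be a field of characteristic different from $2$. A *form* over a field is a non-degenerate quadratic form on a finite-dimensional vector space of positive dimension, $\langle a_1,\dots,a_m\rangle$ denotes the diagonal form $a_1X_1^2+\dots+a_mX_m^2$, and $\varphi_L$ denotes the form obtained from $\varphi$ by extending scalars to a field extension $L$. The Witt index $i(\varphi)$ is the unique integer $k\ge 0$ such that $\varphi\simeq\varphi_{\mathrm{an}}\perp k\times\langle 1,-1\rangle$ with $\varphi_{\mathrm{an}}$ an anisotropic (possibly zero-dimensional) quadratic form. For a form $\varphi$ over a field $k$ with $\dim\varphi=d\ge 2$ and $\varphi\not\simeq\langle 1,-1\rangle$, the function field $k(\varphi)$ is the quotient field of the integral domain $k[X_1,\dots,X_d]/(\varphi(X_1,\dots,X_d))$; if $\dim\varphi=1$ or $\varphi\simeq\langle 1,-1\rangle$, one sets $k(\varphi)=k$. **Theorem.** Let $p$ and $q$ be forms over $F$, possibly isotropic, of dimension at least two, and let $n\ge 0$ be an integer. Over the iterated Laurent series field $K=F(\!(x_1)\!)\cdots(\!(x_n)\!)$ let $\pi=\langle 1,-x_1\rangle\otimes\cdots\otimes\langle 1,-x_n\rangle$ (for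 $n=0$: $K=F$ and $\pi=\langle 1\rangle$), and consider the forms $\pi\otimes p_K$ and $\pi\otimes q_K$ over $K$. Then $$i\bigl((\pi\otimes q_K)_{K(\pi\otimes p_K)}\bigr)=(\dim\pi)\; i\bigl(q_{F(p)}\bigr).$$ -/

import Mathlib

open scoped TensorProduct LaurentSeries

universe u v w

noncomputable section

namespace QuadForm

section Basic

variable (F : Type u) [Field F]

/-- The two-dimensional diagonal form `⟨a, b⟩`, that is `a X² + b Y²`. -/
def binary (a b : F) : QuadraticForm F (Fin 2 → F) :=
  QuadraticMap.weightedSumSquares F ![a, b]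

/-- The hyperbolic plane `⟨1, -1⟩`. -/
def hyperbolicPlane : QuadraticForm F (Fin 2 → F) :=
  binary F 1 (-1)

/-- `k × ⟨1, -1⟩`, the orthogonal sum of `k` hyperbolic planes. -/
def hyperbolicSum (k : ℕ) : QuadraticForm F (Fin k → Fin 2 → F) :=
  QuadraticMap.pi fun _ : Fin k => hyperbolicPlane F

variable {F} {V : Type v} [AddCommGroup V] [Module F V]

/-- `HasWittIndex Q k` : there is a decomposition `Q ≃ r ⊥ k × ⟨1, -1⟩` with `r` anisotropic
(`r` may be zero-dimensional). -/
def HasWittIndex (Q : QuadraticForm F V) (k : ℕ) : Prop :=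
  ∃ (m : ℕ) (r : QuadraticForm F (Fin m → F)),
    r.Anisotropic ∧ QuadraticMap.Equivalent Q (r.prod (hyperbolicSum F k))

/-- The Witt index `i(Q)`: the number `k` of hyperbolic planes in a Witt decomposition
`Q ≃ Q_an ⊥ k × ⟨1, -1⟩`. For a non-degenerate form on a finite-dimensional space in
characteristic not two, exactly one `k` occurs, so that the supremum is that `k`. -/
def wittIndex (Q : QuadraticForm F V) : ℕ :=
  sSup {k : ℕ | HasWittIndex Q k}

end Basic

section FunctionField

variable {F : Type u} [Field F] [Invertible (2 : F)]
variable {V : Type v} [AddCommGroup V] [Module F V] [FiniteDimensional F V]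

/-- The form `Q` as a homogeneous quadratic polynomial `Q(X_1, …, X_d)`, `d = dim Q`, in the
coordinates of a basis of `V`. -/
def toPolynomial (Q : QuadraticForm F V) : MvPolynomial (Fin (Module.finrank F V)) F :=
  ∑ i, ∑ j, MvPolynomial.C (QuadraticMap.associated (R := F) Q (Module.finBasis F V i)
    (Module.finBasis F V j)) * MvPolynomial.X i * MvPolynomial.X j

open Classical in
/-- The ideal `(Q(X_1, …, X_d))` if this polynomial is irreducible, and otherwise the ideal
`(X_1, …, X_d)` of the origin, whose residue ring is `F`. The second case is the convention
`F(Q) = F`; see `irreducible_toPolynomial_iff` and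
`not_irreducible_toPolynomial_of_finrank_eq_one` for when it occurs. -/
def functionIdeal (Q : QuadraticForm F V) :
    Ideal (MvPolynomial (Fin (Module.finrank F V)) F) :=
  if Irreducible (toPolynomial Q) then Ideal.span {toPolynomial Q}
  else RingHom.ker (MvPolynomial.constantCoeff (σ := Fin (Module.finrank F V)) (R := F))

instance functionIdeal_isPrime (Q : QuadraticForm F V) : (functionIdeal Q).IsPrime := by
  unfold functionIdeal
  split_ifs with h
  · exact (Ideal.span_singleton_prime h.ne_zero).2 h.prime
  · exact RingHom.ker_isPrime _

/-- The function field `F(Q)`: the quotient field of `F[X_1, …, X_d] / (Q(X_1, …, X_d))` if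
`Q(X_1, …, X_d)` is irreducible, and `F` itself otherwise. -/
def FunctionField (Q : QuadraticForm F V) : Type u :=
  FractionRing (MvPolynomial (Fin (Module.finrank F V)) F ⧸ functionIdeal Q)

instance (Q : QuadraticForm F V) : Field (FunctionField Q) :=
  inferInstanceAs
    (Field (FractionRing (MvPolynomial (Fin (Module.finrank F V)) F ⧸ functionIdeal Q)))

instance (Q : QuadraticForm F V) : Algebra F (FunctionField Q) :=
  inferInstanceAs
    (Algebra F (FractionRing (MvPolynomial (Fin (Module.finrank F V)) F ⧸ functionIdeal Q)))

/-- If the polynomial is reducible, then `F(Q) = F`. -/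
theorem algebraMap_functionField_bijective (Q : QuadraticForm F V)
    (h : ¬ Irreducible (toPolynomial Q)) :
    Function.Bijective (algebraMap F (FunctionField Q)) := by
  refine ⟨(algebraMap F (FunctionField Q)).injective, ?_⟩
  let R := MvPolynomial (Fin (Module.finrank F V)) F ⧸ functionIdeal Q
  have hR : Function.Surjective (algebraMap F R) := by
    intro r
    obtain ⟨f, rfl⟩ := Ideal.Quotient.mk_surjective r
    refine ⟨MvPolynomial.constantCoeff f, ?_⟩
    change Ideal.Quotient.mk _ (MvPolynomial.C _) = _
    rw [Ideal.Quotient.eq, functionIdeal, if_neg h, RingHom.mem_ker]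
    simp
  intro z
  obtain ⟨x, y, -, rfl⟩ := IsFractionRing.div_surjective (A := R) (K := FractionRing R) z
  obtain ⟨x, rfl⟩ := hR x
  obtain ⟨y, rfl⟩ := hR y
  refine ⟨x / y, ?_⟩
  change algebraMap F (FractionRing R) _ = _
  rw [map_div₀, IsScalarTower.algebraMap_apply F R (FractionRing R),
    IsScalarTower.algebraMap_apply F R (FractionRing R)]

theorem eval_toPolynomial (Q : QuadraticForm F V) (x : Fin (Module.finrank F V) → F) :
    MvPolynomial.eval x (toPolynomial Q) = Q ((Module.finBasis F V).equivFun.symm x) := by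
  rw [← QuadraticMap.associated_eq_self_apply F Q]
  simp only [toPolynomial, Module.Basis.equivFun_symm_apply, map_sum, map_mul,
    MvPolynomial.eval_C, MvPolynomial.eval_X, LinearMap.sum_apply, map_smul,
    LinearMap.smul_apply, smul_eq_mul, Finset.mul_sum]
  rw [Finset.sum_comm]
  refine Finset.sum_congr rfl fun i _ => Finset.sum_congr rfl fun j _ => ?_
  ring

/-- The polynomial of a product of two linear forms is reducible. -/
theorem not_irreducible_of_eq_mul (Q : QuadraticForm F V) (f g : V →ₗ[F] F)
    (h : ∀ x, Q x = f x * g x) : ¬ Irreducible (toPolynomial Q) := by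
  have two : (⅟(2 : F)) * 2 = 1 := invOf_mul_self _
  have hB : ∀ x y, QuadraticMap.associated (R := F) Q x y =
      ⅟(2 : F) * (f x * g y + f y * g x) := by
    intro x y
    rw [QuadraticMap.associated_apply, h, h, h]
    simp only [map_add, Module.End.smul_def, QuadraticMap.half_moduleEnd_apply_eq_half_smul, smul_eq_mul]
    ring
  let L : (V →ₗ[F] F) → MvPolynomial (Fin (Module.finrank F V)) F := fun f =>
    ∑ i, MvPolynomial.C (f (Module.finBasis F V i)) * MvPolynomial.X i
  have hL : ∀ f, ¬ IsUnit (L f) := by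
    intro f hf
    have := hf.map (MvPolynomial.constantCoeff (σ := Fin (Module.finrank F V)) (R := F))
    simp [L] at this
  have key : toPolynomial Q = L f * L g := by
    have e : toPolynomial Q = MvPolynomial.C (⅟(2 : F)) * (L f * L g + L g * L f) := by
      simp only [toPolynomial, hB, L, Finset.sum_mul_sum, map_mul, map_add]
      simp only [← Finset.sum_add_distrib, Finset.mul_sum]
      refine Finset.sum_congr rfl fun i _ => Finset.sum_congr rfl fun j _ => ?_
      ring
    rw [e, mul_comm (L g), ← two_mul, ← mul_assoc]
    have : (2 : MvPolynomial (Fin (Module.finrank F V)) F) = MvPolynomial.C 2 := by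
      exact (map_ofNat _ _).symm
    rw [this, ← map_mul, two, map_one, one_mul]
  intro hirr
  rcases hirr.isUnit_or_isUnit key with h1 | h1
  · exact hL _ h1
  · exact hL _ h1

theorem eq_of_totalDegree_le_one {k : Type u} [Field k] {d : ℕ} (f : MvPolynomial (Fin d) k)
    (hf : f.totalDegree ≤ 1) :
    f = MvPolynomial.C (f.coeff 0) +
      ∑ i, MvPolynomial.C (f.coeff (Finsupp.single i 1)) * MvPolynomial.X i := by
  classical
  ext m
  rw [MvPolynomial.coeff_add, MvPolynomial.coeff_C, MvPolynomial.coeff_sum]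
  simp only [MvPolynomial.coeff_C_mul, MvPolynomial.coeff_X]
  by_cases h0 : m = 0
  · subst h0
    simp
  by_cases h1 : ∃ i, Finsupp.single i 1 = m
  · obtain ⟨i, rfl⟩ := h1
    have : ∀ j : Fin d, (Finsupp.single j 1 = (Finsupp.single i 1 : Fin d →₀ ℕ)) ↔ j = i := by
      intro j
      exact Finsupp.single_left_inj one_ne_zero
    simp only [this]
    simp [eq_comm (a := (0 : Fin d →₀ ℕ))]
  · rw [MvPolynomial.coeff_eq_zero_of_totalDegree_lt, if_neg (Ne.symm h0)]
    · rw [Finset.sum_eq_zero, add_zero]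
      intro i _
      rw [if_neg (fun h => h1 ⟨i, h⟩), mul_zero]
    · by_contra hlt
      have hle : m.degree ≤ 1 := by
        rw [Finsupp.degree_apply]
        omega
      obtain ⟨i, hi⟩ := Finsupp.ne_iff.1 h0
      have hi' : 1 ≤ m i := Nat.one_le_iff_ne_zero.2 hi
      have hsub : (m - Finsupp.single i 1) + Finsupp.single i 1 = m :=
        tsub_add_cancel_of_le (Finsupp.single_le_iff.2 hi')
      have hdeg := congrArg Finsupp.degree hsub
      rw [map_add, Finsupp.degree_single] at hdeg
      have hz : (m - Finsupp.single i 1).degree = 0 := by omega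
      rw [Finsupp.degree_eq_zero_iff] at hz
      rw [hz, zero_add] at hsub
      exact h1 ⟨i, hsub⟩

/-- A nonzero form with a reducible polynomial is a product of two linear forms. -/
theorem exists_eq_mul_of_not_irreducible (Q : QuadraticForm F V) (hQ : ∃ v, Q v ≠ 0)
    (h : ¬ Irreducible (toPolynomial Q)) :
    ∃ f g : V →ₗ[F] F, ∀ x, Q x = f x * g x := by
  have hne : toPolynomial Q ≠ 0 := by
    intro h0
    obtain ⟨v, hv⟩ := hQ
    have := eval_toPolynomial Q ((Module.finBasis F V).equivFun v)
    rw [h0, map_zero, LinearEquiv.symm_apply_apply] at this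
    exact hv this.symm
  have hnu : ¬ IsUnit (toPolynomial Q) := by
    intro hu
    have := hu.map (MvPolynomial.constantCoeff (σ := Fin (Module.finrank F V)) (R := F))
    simp [toPolynomial] at this
  rw [irreducible_iff] at h
  push Not at h
  obtain ⟨a, b, hab, ha, hb⟩ := h hnu
  have ha0 : a ≠ 0 := by rintro rfl; simp_all
  have hb0 : b ≠ 0 := by rintro rfl; simp_all
  have hdeg : (toPolynomial Q).totalDegree ≤ 2 := by
    have hom : (toPolynomial Q).IsHomogeneous 2 := by
      refine MvPolynomial.IsHomogeneous.sum _ _ _ fun i _ =>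
        MvPolynomial.IsHomogeneous.sum _ _ _ fun j _ => ?_
      exact ((MvPolynomial.isHomogeneous_C_mul_X _ _).mul (MvPolynomial.isHomogeneous_X _ _))
    exact hom.totalDegree_le
  rw [hab, MvPolynomial.totalDegree_mul_of_isDomain ha0 hb0] at hdeg
  have pos : ∀ c : MvPolynomial (Fin (Module.finrank F V)) F, c ≠ 0 → ¬ IsUnit c →
      1 ≤ c.totalDegree := by
    intro c hc hcu
    by_contra hlt
    have h0 : c.totalDegree = 0 := by omega
    rw [MvPolynomial.totalDegree_eq_zero_iff_eq_C] at h0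
    refine hcu ?_
    rw [h0]
    refine (isUnit_iff_ne_zero.2 fun hz => hc ?_).map MvPolynomial.C
    rw [h0, hz, map_zero]
  have ea := eq_of_totalDegree_le_one a (by have := pos b hb0 hb; omega)
  have eb := eq_of_totalDegree_le_one b (by have := pos a ha0 ha; omega)
  let ℓ : MvPolynomial (Fin (Module.finrank F V)) F → V →ₗ[F] F := fun c =>
    ∑ i, (c.coeff (Finsupp.single i 1)) • (Module.finBasis F V).coord i
  have ev : ∀ c : MvPolynomial (Fin (Module.finrank F V)) F,
      c = MvPolynomial.C (c.coeff 0) +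
        ∑ i, MvPolynomial.C (c.coeff (Finsupp.single i 1)) * MvPolynomial.X i →
      ∀ v, MvPolynomial.eval ((Module.finBasis F V).equivFun v) c = c.coeff 0 + ℓ c v := by
    intro c hc v
    conv_lhs => rw [hc]
    simp [ℓ]
  have hv : ∀ v, Q v = (a.coeff 0 + ℓ a v) * (b.coeff 0 + ℓ b v) := by
    intro v
    have := eval_toPolynomial Q ((Module.finBasis F V).equivFun v)
    rw [LinearEquiv.symm_apply_apply, hab, map_mul, ev a ea, ev b eb] at this
    exact this.symm
  refine ⟨ℓ a, ℓ b, fun v => ?_⟩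
  have h0 := hv 0
  have h1 := hv v
  have h2 := hv (-v)
  rw [QuadraticMap.map_neg] at h2
  rw [QuadraticMap.map_zero] at h0
  simp only [map_zero, map_neg, add_zero] at h0 h2
  have two : (⅟(2 : F)) * 2 = 1 := invOf_mul_self _
  linear_combination (1 - ⅟(2 : F)) * h1 + ⅟(2 : F) * h2 - h0 - (ℓ a v * b.coeff 0 + ℓ b v * a.coeff 0) * two

theorem irreducible_toPolynomial_iff (Q : QuadraticForm F V) (hQ : Q.Nondegenerate)
    (hd : 2 ≤ Module.finrank F V) :
    Irreducible (toPolynomial Q) ↔ ¬ QuadraticMap.Equivalent Q (hyperbolicPlane F) := by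
  have two : (⅟(2 : F)) * 2 = 1 := invOf_mul_self _
  have hH : ∀ z : Fin 2 → F, hyperbolicPlane F z = (z 0 + z 1) * (z 0 - z 1) := by
    intro z
    simp [hyperbolicPlane, binary, QuadraticMap.weightedSumSquares_apply, Fin.sum_univ_two]
    ring
  constructor
  · rintro hirr ⟨e⟩
    refine not_irreducible_of_eq_mul Q
      (((LinearMap.proj 0 : (Fin 2 → F) →ₗ[F] F) + LinearMap.proj 1) ∘ₗ e.toLinearEquiv.toLinearMap)
      (((LinearMap.proj 0 : (Fin 2 → F) →ₗ[F] F) - LinearMap.proj 1) ∘ₗ e.toLinearEquiv.toLinearMap) (fun x => ?_) hirr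
    rw [← e.map_app x, hH]
    rfl
  · intro hne
    by_contra hirr
    refine hne ?_
    have hrad := hQ.radical_eq_bot
    have hex : ∃ v, Q v ≠ 0 := by
      by_contra hall
      push Not at hall
      have : Q.radical = ⊤ := by
        rw [eq_top_iff]
        intro v _
        rw [QuadraticMap.mem_radical_iff']
        exact ⟨hall v, fun n => by rw [hall, hall]⟩
      rw [hrad] at this
      have h1 : Module.finrank F (⊤ : Submodule F V) = 0 := by rw [← this]; simp
      rw [finrank_top] at h1
      omega
    obtain ⟨f, g, hfg⟩ := exists_eq_mul_of_not_irreducible Q hex hirr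
    let φ : V →ₗ[F] (Fin 2 → F) :=
      LinearMap.pi ![⅟(2 : F) • (f + g), ⅟(2 : F) • (f - g)]
    have φ0 : ∀ v, φ v 0 = ⅟(2 : F) * (f v + g v) := fun v => rfl
    have φ1 : ∀ v, φ v 1 = ⅟(2 : F) * (f v - g v) := fun v => rfl
    have hf : ∀ v, f v = φ v 0 + φ v 1 := by
      intro v
      rw [φ0, φ1]
      linear_combination (- f v) * two
    have hg : ∀ v, g v = φ v 0 - φ v 1 := by
      intro v
      rw [φ0, φ1]
      linear_combination (- g v) * two
    have hinj : Function.Injective φ := by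
      rw [← LinearMap.ker_eq_bot, eq_bot_iff, ← hrad]
      intro v hv
      rw [LinearMap.mem_ker] at hv
      have fv : f v = 0 := by rw [hf, hv]; simp
      have gv : g v = 0 := by rw [hg, hv]; simp
      rw [QuadraticMap.mem_radical_iff']
      refine ⟨by rw [hfg, fv, zero_mul], fun n => ?_⟩
      rw [hfg, hfg, map_add, map_add, fv, gv, zero_add, zero_add]
    have hfin : Module.finrank F V = Module.finrank F (Fin 2 → F) := by
      have := LinearMap.finrank_le_finrank_of_injective hinj
      rw [Module.finrank_fin_fun] at *
      omega
    refine ⟨{ LinearMap.linearEquivOfInjective φ hinj hfin with map_app' := fun v => ?_ }⟩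
    change hyperbolicPlane F (φ v) = Q v
    rw [hH, ← hf, ← hg, hfg]

theorem not_irreducible_toPolynomial_of_finrank_eq_one (Q : QuadraticForm F V)
    (hd : Module.finrank F V = 1) : ¬ Irreducible (toPolynomial Q) := by
  obtain ⟨v, -, hv⟩ := finrank_eq_one_iff'.1 hd
  let b : Module.Basis (Fin 1) F V := Module.basisUnique (Fin 1) hd
  refine not_irreducible_of_eq_mul Q (Q (b 0) • b.coord 0) (b.coord 0) fun x => ?_
  have hx : x = b.coord 0 x • b 0 := by
    have := b.sum_repr x
    rw [Fin.sum_univ_one] at this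
    exact this.symm
  conv_lhs => rw [hx, QuadraticMap.map_smul]
  simp only [LinearMap.smul_apply, smul_eq_mul]
  ring

end FunctionField

section Laurent

/-- The iterated Laurent series field `F((x_1))…((x_n))`. -/
def IteratedLaurent : (n : ℕ) → (F : Type u) → [Field F] → Type u
  | 0, F, _ => F
  | n + 1, F, _ => IteratedLaurent n F⸨X⸩

instance IteratedLaurent.instField : (n : ℕ) → (F : Type u) → [Field F] →
    Field (IteratedLaurent n F)
  | 0, _, inst => inst
  | n + 1, F, _ => IteratedLaurent.instField n F⸨X⸩

instance IteratedLaurent.instAlgebra : (n : ℕ) → (F : Type u) → [Field F] →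
    Algebra F (IteratedLaurent n F)
  | 0, F, _ => Algebra.id F
  | n + 1, F, _ =>
    letI := IteratedLaurent.instAlgebra n F⸨X⸩
    ((algebraMap F⸨X⸩ (IteratedLaurent n F⸨X⸩)).comp (algebraMap F F⸨X⸩)).toAlgebra

instance IteratedLaurent.instInvertibleTwo (n : ℕ) (F : Type u) [Field F] [Invertible (2 : F)] :
    Invertible (2 : IteratedLaurent n F) :=
  (Invertible.map (algebraMap F (IteratedLaurent n F)) 2).copy 2 (map_ofNat _ _).symm

/-- The variables `x_1, …, x_n` of `F((x_1))…((x_n))` (indexed from `0`): the first one is the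
variable of `F((x_1))`, embedded in `F((x_1))…((x_n))`. -/
def IteratedLaurent.var : (n : ℕ) → (F : Type u) → [Field F] → Fin n → IteratedLaurent n F
  | 0, _, _ => Fin.elim0
  | n + 1, F, _ =>
    Fin.cons (algebraMap F⸨X⸩ (IteratedLaurent n F⸨X⸩) (HahnSeries.single 1 1))
      (IteratedLaurent.var n F⸨X⸩)

end Laurent

section Pfister

variable {K : Type u} [Field K] [Invertible (2 : K)]

/-- The form `⟨1, -a_1⟩ ⊗ … ⊗ ⟨1, -a_n⟩`, bundled with its underlying vector space;
it is `⟨1⟩` for `n = 0`. -/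
def pfister : (n : ℕ) → (Fin n → K) → QuadraticModuleCat.{u} K
  | 0, _ => QuadraticModuleCat.of (QuadraticMap.sq (R := K))
  | n + 1, a => QuadraticModuleCat.of
      (QuadraticForm.tmul (binary K 1 (-(a 0))) (pfister n (Fin.tail a)).form)

instance pfister_finite : (n : ℕ) → (a : Fin n → K) → FiniteDimensional K (pfister n a)
  | 0, _ => inferInstanceAs (FiniteDimensional K K)
  | n + 1, a =>
    haveI := pfister_finite n (Fin.tail a)
    inferInstanceAs (FiniteDimensional K ((Fin 2 → K) ⊗[K] (pfister n (Fin.tail a))))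

end Pfister

end QuadForm

end

/-! Write `G` and `S` for the Gram matrices of `p` and `q`. The function field `F(p)` is a generic
extension making `p` isotropic: `k ≤ i(q_{F(p)})` holds exactly when `q_M` has a totally isotropic
subspace of dimension `k` for every extension `M/F` with `p_M` isotropic (`IsotropyForces`,
`isotropyForces_iff`). One direction is that `p` is isotropic over `F(p)`. The other is
specialization: a `k`-dimensional totally isotropic subspace over `F(p)` has a common denominator,
and rational points are dense on an isotropic quadric over an infinite field, so some point over `M`
avoids that denominator. A finite `M` is replaced by `M((x))`.

It remains to see that multiplying both forms by `⟨1, -x⟩` over `F((x))` doubles the largest forced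
dimension; `n` repetitions give the factor `2 ^ n = dim π`.

Lower bound (`IsotropyForces.hasIsotropicFrame_twist`): let `⟨1, -x⟩ ⊗ p` be isotropic over `E ⊇
F((x))`, so that `p(a) = x p(b)`. If `p_E` is isotropic, the subspace for `q` is taken twice.
Otherwise `x` is a norm from a quadratic extension `E(√d)` over which `p` becomes isotropic. There
`q` has a totally isotropic subspace of dimension `k`, hence of dimension `2k` over `E`, and the
norm equation embeds it as a totally isotropic subspace of `⟨1, -x⟩ ⊗ q` over `E`.

Upper bound (`exists_hasIsotropicFrame_of_twist_laurentSeries`): if `p_M` is isotropic, so is `⟨1,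
-x⟩ ⊗ p` over `M((x))`. A totally isotropic subspace of `⟨1, -x⟩ ⊗ q` of dimension `m` extends to a
direct summand over `M[[x]]`; its reduction modulo `x` gives a totally isotropic subspace of `q_M`
of dimension at least `m / 2`. -/

noncomputable section

namespace QuadForm

open Matrix Kronecker

/-! ### Totally isotropic direct summands over commutative rings -/

section Frame

variable {ι κ : Type*} [Fintype ι] [Fintype κ]

/-- The symmetric bilinear form with matrix `S` admits `k` vectors that span a totally isotropic
direct summand of rank `k`. -/
def HasIsotropicFrame {R : Type*} [CommRing R] (S : Matrix ι ι R) (k : ℕ) : Prop :=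
  ∃ (A : Matrix ι (Fin k) R) (B : Matrix (Fin k) ι R), Aᵀ * S * A = 0 ∧ B * A = 1

theorem HasIsotropicFrame.map {R R' : Type*} [CommRing R] [CommRing R'] {S : Matrix ι ι R} {k : ℕ}
    (h : HasIsotropicFrame S k) (ρ : R →+* R') : HasIsotropicFrame (S.map ρ) k := by
  obtain ⟨A, B, h1, h2⟩ := h
  refine ⟨A.map ρ, B.map ρ, ?_, ?_⟩
  · rw [← Matrix.transpose_map, ← Matrix.map_mul, ← Matrix.map_mul, h1]
    simp
  · rw [← Matrix.map_mul, h2]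
    simp

theorem mulVec_dotProduct_mulVec_eq_zero {R : Type*} [CommRing R] {S : Matrix ι ι R}
    {A : Matrix ι κ R} (h : Aᵀ * S * A = 0) (x y : κ → R) :
    (A *ᵥ x) ⬝ᵥ S *ᵥ (A *ᵥ y) = 0 := by
  rw [dotProduct_comm, dotProduct_mulVec, ← Matrix.mulVec_transpose, dotProduct_comm,
    Matrix.mulVec_mulVec, Matrix.mulVec_mulVec, h]
  simp

theorem hasIsotropicFrame_of_leftInverse {R : Type*} [CommRing R] {S : Matrix ι ι R} {k : ℕ}
    (g : (Fin k → R) →ₗ[R] (ι → R)) (l : (ι → R) →ₗ[R] (Fin k → R)) (hl : l ∘ₗ g = LinearMap.id)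
    (h0 : ∀ x y, g x ⬝ᵥ S *ᵥ g y = 0) : HasIsotropicFrame S k := by
  classical
  refine ⟨LinearMap.toMatrix' g, LinearMap.toMatrix' l, ?_, ?_⟩
  · ext i j
    have : ((LinearMap.toMatrix' g)ᵀ * S * LinearMap.toMatrix' g) i j =
        g (Pi.single i 1) ⬝ᵥ S *ᵥ g (Pi.single j 1) := by
      rw [dotProduct_mulVec]
      rfl
    rw [this, h0, Matrix.zero_apply]
  · rw [← LinearMap.toMatrix'_comp, hl, LinearMap.toMatrix'_id]

theorem HasIsotropicFrame.exists_linearMap {K : Type*} [Field K] {S : Matrix ι ι K} {k : ℕ}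
    (h : HasIsotropicFrame S k) : ∃ f : (Fin k → K) →ₗ[K] (ι → K),
      Function.Injective f ∧ ∀ x, f x ⬝ᵥ S *ᵥ f x = 0 := by
  obtain ⟨A, B, h1, h2⟩ := h
  refine ⟨A.mulVecLin, ?_, fun x => ?_⟩
  · refine Function.LeftInverse.injective (g := B.mulVecLin) fun x => ?_
    simp [Matrix.mulVec_mulVec, h2]
  · exact mulVec_dotProduct_mulVec_eq_zero h1 x x

theorem dotProduct_mulVec_comm {R : Type*} [CommRing R] {S : Matrix ι ι R} (hS : S.IsSymm)
    (x y : ι → R) : x ⬝ᵥ S *ᵥ y = y ⬝ᵥ S *ᵥ x := by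
  rw [dotProduct_mulVec, dotProduct_comm, ← mulVec_transpose, hS.eq]

theorem dotProduct_mulVec_eq_zero {K : Type*} [Field K] (h2 : (2 : K) ≠ 0) {S : Matrix ι ι K}
    (hS : S.IsSymm) {x y : ι → K} (hx : x ⬝ᵥ S *ᵥ x = 0) (hy : y ⬝ᵥ S *ᵥ y = 0)
    (hxy : (x + y) ⬝ᵥ S *ᵥ (x + y) = 0) : x ⬝ᵥ S *ᵥ y = 0 := by
  rw [mulVec_add, add_dotProduct, dotProduct_add, dotProduct_add, hx, hy,
    dotProduct_mulVec_comm hS y x] at hxy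
  have : 2 * (x ⬝ᵥ S *ᵥ y) = 0 := by linear_combination hxy
  exact (mul_eq_zero.1 this).resolve_left h2

/-- Polarization turns vanishing of the quadratic form into vanishing of the bilinear form, and over
a field an injection splits. Allowing any source `U` lets a space over an extension field, with
scalars restricted, serve as the source. -/
theorem hasIsotropicFrame_of_linearMap {K : Type*} [Field K] (h2 : (2 : K) ≠ 0)
    {S : Matrix ι ι K} (hS : S.IsSymm) {U : Type*} [AddCommGroup U] [Module K U]
    [FiniteDimensional K U] (f : U →ₗ[K] (ι → K)) (hf : Function.Injective f)
    (h0 : ∀ x, f x ⬝ᵥ S *ᵥ f x = 0) {k : ℕ} (hk : k ≤ Module.finrank K U) :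
    HasIsotropicFrame S k := by
  classical
  obtain ⟨b, hb⟩ := exists_linearIndependent_of_le_finrank hk
  let g : (Fin k → K) →ₗ[K] (ι → K) := f ∘ₗ Fintype.linearCombination K b
  have hg : LinearMap.ker g = ⊥ := by
    rw [LinearMap.ker_eq_bot]
    exact hf.comp (linearIndependent_iff_injective_fintypeLinearCombination.1 hb)
  obtain ⟨l, hl⟩ := g.exists_leftInverse_of_injective hg
  refine hasIsotropicFrame_of_leftInverse g l hl fun x y =>
    dotProduct_mulVec_eq_zero h2 hS (h0 _) (h0 _) ?_
  rw [← map_add]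
  exact h0 _

theorem map_dotProduct_mulVec {R R' : Type*} [CommRing R] [CommRing R'] (ρ : R →+* R')
    (S : Matrix ι ι R) (x y : ι → R) :
    (ρ ∘ x) ⬝ᵥ (S.map ρ) *ᵥ (ρ ∘ y) = ρ (x ⬝ᵥ S *ᵥ y) := by
  rw [RingHom.map_dotProduct]
  congr 1
  ext i
  exact (RingHom.map_mulVec ρ S y i).symm

/-- The form with matrix `S` has a nonzero isotropic vector. -/
def IsIsotropic {R : Type*} [CommRing R] (S : Matrix ι ι R) : Prop :=
  ∃ v : ι → R, v ≠ 0 ∧ v ⬝ᵥ S *ᵥ v = 0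

theorem IsIsotropic.map {K K' : Type*} [Field K] [Field K'] {S : Matrix ι ι K}
    (h : IsIsotropic S) (ρ : K →+* K') : IsIsotropic (S.map ρ) := by
  obtain ⟨v, hv, h0⟩ := h
  refine ⟨ρ ∘ v, fun h => hv ?_, by rw [map_dotProduct_mulVec, h0, map_zero]⟩
  ext i
  exact ρ.injective (by simpa using congrFun h i)

/-- The integral points `Λ` of the isotropic subspace form a saturated submodule, so the quotient by
`Λ` is torsion-free, hence free over the principal ideal domain, and `Λ` splits off. Keeping a
splitting, and not merely independent vectors, is what lets the frame survive reduction modulo a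
prime. -/
theorem hasIsotropicFrame_of_fractionRing {R K : Type*} [CommRing R] [IsDomain R]
    [IsPrincipalIdealRing R] [Field K] [Algebra R K] [IsFractionRing R K] {S : Matrix ι ι R}
    {k : ℕ} (h : HasIsotropicFrame (S.map (algebraMap R K)) k) : HasIsotropicFrame S k := by
  classical
  obtain ⟨A, B, h1, h2⟩ := h
  let φ : (ι → R) →ₗ[R] (ι → K) := (Algebra.linearMap R K).compLeft ι
  have hφ : ∀ x, φ x = algebraMap R K ∘ x := fun x => rfl
  have hφinj : Function.Injective φ := fun x y hxy => by
    ext i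
    exact IsFractionRing.injective R K (congrFun hxy i)
  let U : Submodule K (ι → K) := LinearMap.range A.mulVecLin
  have hU0 : ∀ x ∈ U, ∀ y ∈ U, x ⬝ᵥ (S.map (algebraMap R K)) *ᵥ y = 0 := by
    rintro _ ⟨x, rfl⟩ _ ⟨y, rfl⟩
    exact mulVec_dotProduct_mulVec_eq_zero h1 x y
  let Λ : Submodule R (ι → R) := (U.restrictScalars R).comap φ
  have hΛ : ∀ x, x ∈ Λ ↔ φ x ∈ U := fun x => Iff.rfl
  have hsat : ∀ (r : R) (x : ι → R), r ≠ 0 → r • x ∈ Λ → x ∈ Λ := by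
    intro r x hr hx
    rw [hΛ, map_smul] at hx
    rw [hΛ]
    have hr' : algebraMap R K r ≠ 0 := by
      rwa [Ne, IsFractionRing.to_map_eq_zero_iff]
    rw [← algebraMap_smul K r (φ x)] at hx
    exact (U.smul_mem_iff hr').1 hx
  have : Module.IsTorsionFree R ((ι → R) ⧸ Λ) := by
    refine Module.IsTorsionFree.of_smul_eq_zero fun r x hx => ?_
    obtain ⟨x, rfl⟩ := Submodule.Quotient.mk_surjective _ x
    rw [← Submodule.Quotient.mk_smul, Submodule.Quotient.mk_eq_zero] at hx
    by_cases hr : r = 0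
    · exact Or.inl hr
    · exact Or.inr ((Submodule.Quotient.mk_eq_zero _).2 (hsat r x hr hx))
  obtain ⟨s, hs⟩ := Λ.mkQ.exists_rightInverse_of_surjective Λ.range_mkQ
  let r : (ι → R) →ₗ[R] Λ := LinearMap.codRestrict Λ (LinearMap.id - s ∘ₗ Λ.mkQ) fun x => by
    rw [← Submodule.Quotient.mk_eq_zero, ← Submodule.mkQ_apply, LinearMap.sub_apply, map_sub]
    have := LinearMap.congr_fun hs (Λ.mkQ x)
    simp only [LinearMap.comp_apply, LinearMap.id_apply] at this ⊢
    rw [this, sub_self]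
  have hr : r ∘ₗ Λ.subtype = LinearMap.id := by
    ext1 x
    apply Subtype.ext
    have : Λ.mkQ (x : ι → R) = 0 := (Submodule.Quotient.mk_eq_zero _).2 x.2
    change (x : ι → R) - s (Λ.mkQ x) = x
    rw [this, map_zero, sub_zero]
  have hrank : k ≤ Module.finrank R Λ := by
    -- Clearing denominators in the columns of `A` gives `k` independent elements of `Λ`;
    -- independence is detected by the left inverse `B`.
    obtain ⟨d, hd⟩ := IsLocalization.exist_integer_multiples_of_finite (nonZeroDivisors R)
      (fun ij : ι × Fin k => A ij.1 ij.2)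
    choose a ha using hd
    have hd0 : algebraMap R K d ≠ 0 := by
      rw [Ne, IsFractionRing.to_map_eq_zero_iff]
      exact nonZeroDivisors.coe_ne_zero d
    have hcol : ∀ c : Fin k → R, φ (fun i => ∑ j, c j * a (i, j)) =
        A *ᵥ (algebraMap R K d • (algebraMap R K ∘ c)) := by
      intro c
      ext i
      simp only [hφ, Function.comp_apply, map_sum, map_mul, ha, Matrix.mulVec, dotProduct,
        Pi.smul_apply, smul_eq_mul, Algebra.smul_def]
      refine Finset.sum_congr rfl fun j _ => by ring
    let g : (Fin k → R) →ₗ[R] Λ := LinearMap.codRestrict Λ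
      (Matrix.mulVecLin (Matrix.of fun i j => a (i, j))) fun c => by
        rw [hΛ]
        refine ⟨algebraMap R K d • (algebraMap R K ∘ c), ?_⟩
        rw [mulVecLin_apply, ← hcol]
        congr 1
        ext i
        simp [Matrix.mulVec, dotProduct, mul_comm]
    have hg : Function.Injective g := by
      rw [← LinearMap.ker_eq_bot, eq_bot_iff]
      intro c hc
      have h3 : (fun i => ∑ j, c j * a (i, j)) = 0 := by
        have := congrArg Subtype.val (LinearMap.mem_ker.1 hc)
        rw [← show (g c : ι → R) = 0 from this]
        ext i
        simp [g, Matrix.mulVec, dotProduct, mul_comm]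
      have h4 := hcol c
      rw [h3, map_zero] at h4
      have h5 := congrArg (B *ᵥ ·) h4
      simp only [Matrix.mulVec_mulVec, h2, Matrix.one_mulVec, Matrix.mulVec_zero] at h5
      ext j
      have h6 := congrFun h5 j
      simp only [Pi.zero_apply, Pi.smul_apply, smul_eq_mul, Function.comp_apply] at h6
      have h7 := (mul_eq_zero.1 h6.symm).resolve_left hd0
      rwa [IsFractionRing.to_map_eq_zero_iff] at h7
    simpa using LinearMap.finrank_le_finrank_of_injective hg
  let b := Module.finBasis R Λ
  let e : Fin k → Fin (Module.finrank R Λ) := Fin.castLE hrank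
  let g : (Fin k → R) →ₗ[R] Λ := Fintype.linearCombination R fun j => b (e j)
  let l : Λ →ₗ[R] (Fin k → R) := LinearMap.pi fun j => b.coord (e j)
  have hlg : l ∘ₗ g = LinearMap.id := by
    refine LinearMap.pi_ext' fun j => LinearMap.ext_ring ?_
    ext i
    simp [l, g, Fintype.linearCombination_apply_single, Finsupp.single_apply, Pi.single_apply, e,
      eq_comm]
  refine hasIsotropicFrame_of_leftInverse (Λ.subtype ∘ₗ g) (l ∘ₗ r) ?_ fun x y => ?_
  · rw [LinearMap.comp_assoc, ← LinearMap.comp_assoc g, hr, LinearMap.id_comp, hlg]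
  · have := hU0 _ (g x).2 _ (g y).2
    rw [hφ, hφ, map_dotProduct_mulVec] at this
    exact (IsFractionRing.to_map_eq_zero_iff (K := K)).1 this

end Frame

/-! ### Witt decomposition and the Witt index as a maximal isotropic dimension -/

section Witt

variable {K : Type u} [Field K] [Invertible (2 : K)] {V : Type v} [AddCommGroup V] [Module K V]

omit [Invertible (2 : K)] in
theorem hyperbolicPlane_apply (z : Fin 2 → K) :
    hyperbolicPlane K z = (z 0 - z 1) * (z 0 + z 1) := by
  simp [hyperbolicPlane, binary, QuadraticMap.weightedSumSquares_apply, Fin.sum_univ_two]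
  ring

omit [Invertible (2 : K)] in
theorem prod_hyperbolicSum_apply {m k : ℕ} (r : QuadraticForm K (Fin m → K))
    (z : (Fin m → K) × (Fin k → Fin 2 → K)) :
    r.prod (hyperbolicSum K k) z = r z.1 + ∑ i, (z.2 i 0 - z.2 i 1) * (z.2 i 0 + z.2 i 1) := by
  simp [hyperbolicSum, QuadraticMap.pi_apply, hyperbolicPlane_apply]

omit [Invertible (2 : K)] in
theorem HasWittIndex.exists_linearMap {Q : QuadraticForm K V} {k : ℕ} (h : HasWittIndex Q k) :
    ∃ f : (Fin k → K) →ₗ[K] V, Function.Injective f ∧ ∀ x, Q (f x) = 0 := by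
  obtain ⟨m, r, -, ⟨e⟩⟩ := h
  let g : (Fin k → K) →ₗ[K] (Fin m → K) × (Fin k → Fin 2 → K) :=
    LinearMap.prod 0 (LinearMap.pi fun i => LinearMap.pi fun _ : Fin 2 => LinearMap.proj i)
  refine ⟨e.symm.toLinearEquiv.toLinearMap ∘ₗ g, ?_, fun x => ?_⟩
  · refine e.symm.toLinearEquiv.injective.comp fun x y hxy => ?_
    ext i
    exact congrFun (congrFun (congrArg Prod.snd hxy) i) 0
  · change Q (e.symm (g x)) = 0
    rw [e.symm.map_app, prod_hyperbolicSum_apply]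
    simp [g]

/-- A dimension count that replaces Witt cancellation. In light-cone coordinates `δ`, `σ` on the
hyperbolic part, isotropy reads `r + δ · σ = 0`. Where `δ = 0`, anisotropy kills the `r`-component,
so `σ` embeds `ker δ` into the annihilator of `range δ`; hence `dim ker δ ≤ k - rank δ`. -/
theorem HasWittIndex.le {Q : QuadraticForm K V} {k j : ℕ} (h : HasWittIndex Q k)
    (f : (Fin j → K) →ₗ[K] V) (hf : Function.Injective f) (h0 : ∀ x, Q (f x) = 0) : j ≤ k := by
  obtain ⟨m, r, hr, ⟨e⟩⟩ := h
  have h2 : (2 : K) ≠ 0 := Invertible.ne_zero 2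
  let g : (Fin j → K) →ₗ[K] (Fin m → K) × (Fin k → Fin 2 → K) := e.toLinearEquiv.toLinearMap ∘ₗ f
  have hg : Function.Injective g := e.toLinearEquiv.injective.comp hf
  let δ : (Fin j → K) →ₗ[K] (Fin k → K) := LinearMap.pi fun i =>
    ((LinearMap.proj 0 : (Fin 2 → K) →ₗ[K] K) - LinearMap.proj 1) ∘ₗ LinearMap.proj i ∘ₗ LinearMap.snd K _ _ ∘ₗ g
  let σ : (Fin j → K) →ₗ[K] (Fin k → K) := LinearMap.pi fun i =>
    ((LinearMap.proj 0 : (Fin 2 → K) →ₗ[K] K) + LinearMap.proj 1) ∘ₗ LinearMap.proj i ∘ₗ LinearMap.snd K _ _ ∘ₗ g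
  have hδ : ∀ x i, δ x i = (g x).2 i 0 - (g x).2 i 1 := fun x i => rfl
  have hσ : ∀ x i, σ x i = (g x).2 i 0 + (g x).2 i 1 := fun x i => rfl
  have hQ : ∀ x, r (g x).1 + δ x ⬝ᵥ σ x = 0 := by
    intro x
    rw [← h0 x, ← e.map_app, prod_hyperbolicSum_apply]
    rfl
  have hker : ∀ x, δ x = 0 → (g x).1 = 0 := by
    intro x hx
    have := hQ x
    rw [hx, zero_dotProduct, add_zero] at this
    exact hr _ this
  have hinj : Function.Injective (σ ∘ₗ (LinearMap.ker δ).subtype) := by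
    rw [← LinearMap.ker_eq_bot, eq_bot_iff]
    rintro ⟨x, hx⟩ hσx
    rw [LinearMap.mem_ker] at hx
    have hσx : σ x = 0 := hσx
    have h1 := hker x hx
    have : g x = 0 := by
      refine Prod.ext h1 ?_
      funext i
      have e1 := congrFun hx i
      have e2 := congrFun hσx i
      rw [hδ, Pi.zero_apply] at e1
      rw [hσ, Pi.zero_apply] at e2
      have e3 : 2 * (g x).2 i 0 = 0 := by linear_combination e1 + e2
      have e4 : 2 * (g x).2 i 1 = 0 := by linear_combination e2 - e1
      funext l
      fin_cases l
      · exact (mul_eq_zero.1 e3).resolve_left h2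
      · exact (mul_eq_zero.1 e4).resolve_left h2
    rw [Submodule.mem_bot]
    exact Subtype.ext (hg (this.trans (map_zero g).symm))
  have horth : ∀ x z, δ x = 0 → σ x ⬝ᵥ δ z = 0 := by
    intro x z hx
    have e1 := hQ (x + z)
    have e2 := hQ z
    rw [map_add, Prod.fst_add, hker x hx, zero_add, map_add, map_add, hx, zero_add,
      dotProduct_add] at e1
    rw [dotProduct_comm]
    linear_combination e1 - e2
  let T := LinearMap.range (σ ∘ₗ (LinearMap.ker δ).subtype)
  have hT : T.map (dotProductEquiv K (Fin k)).toLinearMap ≤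
      (LinearMap.range δ).dualAnnihilator := by
    rintro _ ⟨_, ⟨⟨x, hx⟩, rfl⟩, rfl⟩
    rw [Submodule.mem_dualAnnihilator]
    rintro _ ⟨z, rfl⟩
    exact horth x z hx
  have d1 := Submodule.finrank_mono hT
  rw [LinearEquiv.finrank_map_eq, LinearMap.finrank_range_of_inj hinj] at d1
  have d2 := Subspace.finrank_add_finrank_dualAnnihilator_eq (LinearMap.range δ)
  have d3 := δ.finrank_range_add_finrank_ker
  rw [Module.finrank_fin_fun] at d2 d3
  omega

theorem exists_hyperbolic_pair {Q : QuadraticForm K V} (hQ : Q.Nondegenerate) {v : V}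
    (hv : v ≠ 0) (h0 : Q v = 0) :
    ∃ w, Q w = 0 ∧ QuadraticMap.associated (R := K) Q v w = 1 := by
  have hsep := (QuadraticMap.nondegenerate_associated_iff.2 hQ).1
  obtain ⟨w, hw⟩ : ∃ w, QuadraticMap.associated (R := K) Q v w ≠ 0 := by
    by_contra! h
    exact hv (hsep v h)
  let B := QuadraticMap.associated (R := K) Q
  have hBQ : ∀ x, B x x = Q x := QuadraticMap.associated_eq_self_apply K Q
  have hsymm : ∀ x y, B x y = B y x := QuadraticMap.associated_isSymm K Q
  obtain ⟨a, ha⟩ : ∃ a, a * B v w = 1 := ⟨(B v w)⁻¹, inv_mul_cancel₀ hw⟩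
  have h2 := Invertible.ne_zero (2 : K)
  -- After scaling `w` so that its pairing with `v` is `1`, subtracting half its value times `v`
  -- makes it isotropic without changing that pairing.
  refine ⟨a • w - (a ^ 2 * Q w / 2) • v, ?_, ?_⟩
  · rw [← hBQ]
    simp only [map_sub, map_smul, LinearMap.sub_apply, LinearMap.smul_apply, smul_eq_mul, hBQ, h0,
      hsymm w v]
    field_simp
    linear_combination (-4 * Q w * a ^ 2) * ha
  · change B v _ = 1
    simp only [map_sub, map_smul, smul_eq_mul, hBQ, h0]
    linear_combination ha

theorem HasWittIndex.succ_of_hyperbolic_pair {Q : QuadraticForm K V} {v w : V} (hv : Q v = 0)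
    (hw : Q w = 0) (hvw : QuadraticMap.associated (R := K) Q v w = 1) {k : ℕ}
    (h : HasWittIndex (Q.comp (LinearMap.ker (QuadraticMap.associated (R := K) Q v) ⊓
      LinearMap.ker (QuadraticMap.associated (R := K) Q w) : Submodule K V).subtype) k) :
    HasWittIndex Q (k + 1) := by
  set B := QuadraticMap.associated (R := K) Q with hB
  set V' : Submodule K V := LinearMap.ker (B v) ⊓ LinearMap.ker (B w) with hV'
  have hBQ : ∀ x, B x x = Q x := QuadraticMap.associated_eq_self_apply K Q
  have hsymm : ∀ x y, B x y = B y x := QuadraticMap.associated_isSymm K Q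
  have hvv : B v v = 0 := by rw [hBQ, hv]
  have hww : B w w = 0 := by rw [hBQ, hw]
  have hwv : B w v = 1 := by rw [hsymm, hvw]
  have h2 := Invertible.ne_zero (2 : K)
  obtain ⟨m, r, hr, ⟨e⟩⟩ := h
  let t : V →ₗ[K] V' := LinearMap.codRestrict V'
    (LinearMap.id - (B w).smulRight v - (B v).smulRight w) fun x => by
      simp only [hV', Submodule.mem_inf, LinearMap.mem_ker, LinearMap.sub_apply, map_sub,
        LinearMap.id_apply, LinearMap.smulRight_apply, map_smul, smul_eq_mul, hvv, hww, hwv, hvw]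
      constructor <;> ring
  have ht : ∀ x, (t x : V) = x - B w x • v - B v x • w := fun x => rfl
  -- These coordinates satisfy `c₀ + c₁ = B v x` and `c₀ - c₁ = 2 B w x`; their product is the value
  -- of `Q` on the component of `x` in the plane of `v` and `w`.
  let c : V →ₗ[K] (Fin 2 → K) := LinearMap.pi ![(2⁻¹ : K) • B v + B w, (2⁻¹ : K) • B v - B w]
  have c0 : ∀ x, c x 0 = 2⁻¹ * B v x + B w x := fun x => rfl
  have c1 : ∀ x, c x 1 = 2⁻¹ * B v x - B w x := fun x => rfl
  let s : (Fin 2 → K) × V' →ₗ[K] V := LinearMap.coprod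
    (LinearMap.smulRight ((2⁻¹ : K) • ((LinearMap.proj 0 : (Fin 2 → K) →ₗ[K] K) - LinearMap.proj 1)) v +
      LinearMap.smulRight ((LinearMap.proj 0 : (Fin 2 → K) →ₗ[K] K) + LinearMap.proj 1) w) V'.subtype
  have hs : ∀ z, s z = (2⁻¹ * (z.1 0 - z.1 1)) • v + (z.1 0 + z.1 1) • w + z.2 := fun z => rfl
  have hsv : ∀ z, B v (s z) = z.1 0 + z.1 1 := by
    intro z
    have := LinearMap.mem_ker.1 z.2.2.1
    simp only [hs, map_add, map_smul, hvv, hvw, this, smul_eq_mul]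
    ring
  have hsw : ∀ z, B w (s z) = 2⁻¹ * (z.1 0 - z.1 1) := by
    intro z
    have := LinearMap.mem_ker.1 z.2.2.2
    simp only [hs, map_add, map_smul, hww, hwv, this, smul_eq_mul]
    ring
  let e₁ : V ≃ₗ[K] (Fin 2 → K) × V' :=
    { LinearMap.prod c t with
      invFun := s
      left_inv := fun x => by
        change s (c x, t x) = x
        rw [hs]
        simp only [ht, c0, c1]
        have q1 : 2⁻¹ * (2⁻¹ * B v x + B w x - (2⁻¹ * B v x - B w x)) = B w x := by
          field_simp; ring
        have q2 : 2⁻¹ * B v x + B w x + (2⁻¹ * B v x - B w x) = B v x := by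
          field_simp; ring
        rw [q1, q2]
        abel
      right_inv := fun z => by
        change (c (s z), t (s z)) = z
        refine Prod.ext ?_ (Subtype.ext ?_)
        · funext l
          fin_cases l
          · change c (s z) 0 = z.1 0
            rw [c0, hsv, hsw]; field_simp; ring
          · change c (s z) 1 = z.1 1
            rw [c1, hsv, hsw]; field_simp; ring
        · change (t (s z) : V) = z.2
          rw [ht, hsv, hsw, hs]
          abel }
  let e₂ := e₁ ≪≫ₗ LinearEquiv.prodCongr (LinearEquiv.refl K (Fin 2 → K)) e.toLinearEquiv ≪≫ₗ
    (LinearEquiv.prodAssoc K _ _ _).symm ≪≫ₗ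
    LinearEquiv.prodCongr (LinearEquiv.prodComm K _ _) (LinearEquiv.refl K _) ≪≫ₗ
    LinearEquiv.prodAssoc K _ _ _ ≪≫ₗ
    LinearEquiv.prodCongr (LinearEquiv.refl K _) (Fin.consLinearEquiv K fun _ => Fin 2 → K)
  refine ⟨m, r, hr, ⟨{ e₂ with map_app' := fun x => ?_ }⟩⟩
  have e₂x : e₂ x = ((e (t x)).1, Fin.cons (c x) (e (t x)).2) := rfl
  change r.prod (hyperbolicSum K (k + 1)) (e₂ x) = Q x
  have h3 := e.map_app (t x)
  rw [prod_hyperbolicSum_apply] at h3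
  rw [prod_hyperbolicSum_apply, e₂x, Fin.sum_univ_succ]
  simp only [Fin.cons_zero, Fin.cons_succ]
  have h4 : Q x = B x x := (hBQ x).symm
  have h5 : (Q.comp V'.subtype) (t x) = B (t x) (t x) := (hBQ (t x)).symm
  rw [h5, ht] at h3
  simp only [map_sub, map_smul, LinearMap.sub_apply, LinearMap.smul_apply, smul_eq_mul,
    hvv, hww, hvw, hwv, hsymm x v, hsymm x w] at h3
  rw [c0, c1, h4]
  have q1 : (2⁻¹ * B v x + B w x - (2⁻¹ * B v x - B w x)) *
      (2⁻¹ * B v x + B w x + (2⁻¹ * B v x - B w x)) = 2 * B w x * B v x := by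
    field_simp; ring
  rw [q1]
  linear_combination h3

theorem exists_hasWittIndex [FiniteDimensional K V] (Q : QuadraticForm K V)
    (hQ : Q.Nondegenerate) : ∃ k, HasWittIndex Q k := by
  obtain ⟨d, hd⟩ : ∃ d, Module.finrank K V = d := ⟨_, rfl⟩
  induction d using Nat.strong_induction_on generalizing V with
  | _ d ih =>
    by_cases han : Q.Anisotropic
    · let b := (Module.finBasis K V).equivFun
      refine ⟨0, _, Q.comp b.symm.toLinearMap, fun x hx => ?_,
        ⟨{ b ≪≫ₗ LinearEquiv.prodUnique.symm with map_app' := fun x => ?_ }⟩⟩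
      · exact (LinearEquiv.map_eq_zero_iff b.symm).1 (han _ hx)
      · change (Q.comp b.symm.toLinearMap).prod (hyperbolicSum K 0) (b x, default) = Q x
        rw [prod_hyperbolicSum_apply]
        simp
    · obtain ⟨v, h0, hv⟩ : ∃ v, Q v = 0 ∧ v ≠ 0 := by
        simpa [QuadraticMap.Anisotropic] using han
      obtain ⟨w, hw, hvw⟩ := exists_hyperbolic_pair hQ hv h0
      set V' : Submodule K V := LinearMap.ker (QuadraticMap.associated (R := K) Q v) ⊓
        LinearMap.ker (QuadraticMap.associated (R := K) Q w) with hV'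
      have hsymm : ∀ x y, QuadraticMap.associated (R := K) Q x y =
        QuadraticMap.associated (R := K) Q y x := QuadraticMap.associated_isSymm K Q
      have hvv : QuadraticMap.associated (R := K) Q v v = 0 := by
        rw [QuadraticMap.associated_eq_self_apply, h0]
      have hww : QuadraticMap.associated (R := K) Q w w = 0 := by
        rw [QuadraticMap.associated_eq_self_apply, hw]
      have hlt : Module.finrank K V' < d := by
        rw [← hd]
        refine Submodule.finrank_lt fun h => ?_
        have : w ∈ V' := h ▸ Submodule.mem_top
        rw [hV', Submodule.mem_inf, LinearMap.mem_ker, hvw] at this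
        exact one_ne_zero this.1
      have hnd : (Q.comp V'.subtype).Nondegenerate := by
        rw [← QuadraticMap.nondegenerate_associated_iff] at hQ ⊢
        rw [LinearMap.IsRefl.nondegenerate_iff_separatingLeft
          fun x y h => (QuadraticMap.associated_isSymm K (Q.comp V'.subtype) y x).trans h]
        intro x hx
        refine Subtype.ext (hQ.1 _ fun y => ?_)
        have hxv : QuadraticMap.associated (R := K) Q x v = 0 := by
          rw [hsymm]; exact LinearMap.mem_ker.1 x.2.1
        have hxw : QuadraticMap.associated (R := K) Q x w = 0 := by
          rw [hsymm]; exact LinearMap.mem_ker.1 x.2.2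
        have hy : y - QuadraticMap.associated (R := K) Q w y • v -
            QuadraticMap.associated (R := K) Q v y • w ∈ V' := by
          rw [hV', Submodule.mem_inf, LinearMap.mem_ker, LinearMap.mem_ker]
          simp only [map_sub, map_smul, smul_eq_mul, hvv, hww, hvw, hsymm w v]
          constructor <;> ring
        have := hx ⟨_, hy⟩
        rw [QuadraticMap.associated_comp] at this
        simpa [hxv, hxw] using this
      obtain ⟨k, hk⟩ := ih _ hlt (Q.comp V'.subtype) hnd rfl
      exact ⟨k + 1, hk.succ_of_hyperbolic_pair h0 hw hvw⟩

/-- Two Witt decompositions bound each other's index through their totally isotropic subspaces, so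
the set under the supremum is a singleton. -/
theorem hasWittIndex_wittIndex [FiniteDimensional K V] (Q : QuadraticForm K V)
    (hQ : Q.Nondegenerate) : HasWittIndex Q (wittIndex Q) := by
  obtain ⟨k, hk⟩ := exists_hasWittIndex Q hQ
  have : {j | HasWittIndex Q j} = {k} := by
    ext j
    refine ⟨fun hj => ?_, fun hj => by rw [hj]; exact hk⟩
    obtain ⟨f, hf, hf0⟩ := HasWittIndex.exists_linearMap hj
    obtain ⟨g, hg, hg0⟩ := hk.exists_linearMap
    exact le_antisymm (hk.le f hf hf0) (HasWittIndex.le hj g hg hg0)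
  rw [wittIndex, this, csSup_singleton]
  exact hk

variable {ι : Type*} [Fintype ι]

/-- The matrix of the symmetric bilinear form of `Q` in a basis. -/
def gram (Q : QuadraticForm K V) (b : Module.Basis ι K V) : Matrix ι ι K :=
  Matrix.of fun i j => QuadraticMap.associated (R := K) Q (b i) (b j)

omit [Fintype ι] in
theorem gram_isSymm (Q : QuadraticForm K V) (b : Module.Basis ι K V) : (gram Q b).IsSymm := by
  ext i j
  exact QuadraticMap.associated_isSymm K Q _ _

theorem dotProduct_gram_mulVec (Q : QuadraticForm K V) (b : Module.Basis ι K V) (x y : ι → K) :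
    x ⬝ᵥ gram Q b *ᵥ y =
      QuadraticMap.associated (R := K) Q (b.equivFun.symm x) (b.equivFun.symm y) := by
  simp only [Module.Basis.equivFun_symm_apply, map_sum, LinearMap.sum_apply, map_smul,
    LinearMap.smul_apply, smul_eq_mul, dotProduct, mulVec, Finset.mul_sum, gram, Matrix.of_apply]
  rw [Finset.sum_comm]
  refine Finset.sum_congr rfl fun i _ => Finset.sum_congr rfl fun j _ => by ring

theorem dotProduct_gram_mulVec_self (Q : QuadraticForm K V) (b : Module.Basis ι K V)
    (x : ι → K) : x ⬝ᵥ gram Q b *ᵥ x = Q (b.equivFun.symm x) := by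
  rw [dotProduct_gram_mulVec, QuadraticMap.associated_eq_self_apply]

theorem nondegenerate_iff_det_gram_ne_zero [DecidableEq ι] (Q : QuadraticForm K V)
    (b : Module.Basis ι K V) : Q.Nondegenerate ↔ (gram Q b).det ≠ 0 := by
  have : gram Q b = LinearMap.BilinForm.toMatrix b (QuadraticMap.associated (R := K) Q) := by
    ext i j
    simp [gram, LinearMap.BilinForm.toMatrix_apply]
  rw [this, ← LinearMap.BilinForm.nondegenerate_iff_det_ne_zero b]
  exact QuadraticMap.nondegenerate_associated_iff.symm

/-- From here on Witt indices are handled through Gram matrices, which can be moved along ring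
homomorphisms. -/
theorem le_wittIndex_iff (Q : QuadraticForm K V) (hQ : Q.Nondegenerate)
    (b : Module.Basis ι K V) {k : ℕ} :
    k ≤ wittIndex Q ↔ HasIsotropicFrame (gram Q b) k := by
  have := Module.Finite.of_basis b
  constructor
  · intro hk
    obtain ⟨f, hf, h0⟩ := (hasWittIndex_wittIndex Q hQ).exists_linearMap
    refine hasIsotropicFrame_of_linearMap (Invertible.ne_zero 2) (gram_isSymm Q b)
      (b.equivFun.toLinearMap ∘ₗ f) (b.equivFun.injective.comp hf) (fun x => ?_)
      (by rwa [Module.finrank_fin_fun])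
    rw [dotProduct_gram_mulVec_self, LinearMap.comp_apply, LinearEquiv.coe_coe,
      LinearEquiv.symm_apply_apply, h0]
  · intro h
    obtain ⟨f, hf, h0⟩ := h.exists_linearMap
    refine (hasWittIndex_wittIndex Q hQ).le (b.equivFun.symm.toLinearMap ∘ₗ f)
      (b.equivFun.symm.injective.comp hf) fun x => ?_
    rw [LinearMap.comp_apply, LinearEquiv.coe_coe, ← dotProduct_gram_mulVec_self, h0]

end Witt

/-! ### Denominators of frames and density of rational points on an isotropic quadric -/

section Specialization

variable {ι κ : Type*} [Fintype ι] [Fintype κ]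

/-- With `d` and `d'` clearing the denominators of the frame and of its left inverse, all identities
hold over `R` up to the factor `d' * d`; the frame specializes wherever this factor stays nonzero.
-/
theorem HasIsotropicFrame.exists_denominator {R E : Type*} [CommRing R] [IsDomain R] [Field E]
    [Algebra R E] [IsFractionRing R E] {S : Matrix ι ι R} {k : ℕ}
    (h : HasIsotropicFrame (S.map (algebraMap R E)) k) :
    ∃ s : R, s ≠ 0 ∧ ∀ (M : Type w) [Field M] (φ : R →+* M), φ s ≠ 0 →
      HasIsotropicFrame (S.map φ) k := by
  obtain ⟨A, B, h1, h2⟩ := h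
  have hinj := IsFractionRing.injective R E
  obtain ⟨d, hd⟩ := IsLocalization.exist_integer_multiples_of_finite (nonZeroDivisors R)
    (fun ij : ι × Fin k => A ij.1 ij.2)
  obtain ⟨d', hd'⟩ := IsLocalization.exist_integer_multiples_of_finite (nonZeroDivisors R)
    (fun ij : Fin k × ι => B ij.1 ij.2)
  choose a ha using hd
  choose b hb using hd'
  let A' : Matrix ι (Fin k) R := Matrix.of fun i j => a (i, j)
  let B' : Matrix (Fin k) ι R := Matrix.of fun i j => b (i, j)
  have hA : A'.map (algebraMap R E) = algebraMap R E d • A := by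
    ext i j
    simp [A', ha, Algebra.smul_def]
  have hB : B'.map (algebraMap R E) = algebraMap R E d' • B := by
    ext i j
    simp [B', hb, Algebra.smul_def]
  have e1 : A'ᵀ * S * A' = 0 := by
    refine Matrix.map_injective hinj ?_
    simp only [Matrix.map_mul, Matrix.transpose_map, hA]
    simp [h1]
  have e2 : B' * A' = ((d' * d : R)) • (1 : Matrix (Fin k) (Fin k) R) := by
    refine Matrix.map_injective hinj ?_
    simp only [Matrix.map_mul, hA, hB, Matrix.smul_mul, Matrix.mul_smul, h2]
    ext i j
    by_cases hij : i = j
    · subst hij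
      simp [mul_comm]
      rw [Algebra.smul_def, mul_comm]
    · simp [hij]
  refine ⟨d' * d, mul_ne_zero (nonZeroDivisors.coe_ne_zero d') (nonZeroDivisors.coe_ne_zero d),
    fun M _ φ hφ => ⟨A'.map φ, (φ (d' * d))⁻¹ • B'.map φ, ?_, ?_⟩⟩
  · rw [← Matrix.transpose_map, ← Matrix.map_mul, ← Matrix.map_mul, e1]
    simp
  · rw [Matrix.smul_mul, ← Matrix.map_mul, e2]
    ext i j
    by_cases hij : i = j
    · subst hij
      simpa using inv_mul_cancel₀ hφ
    · simp [hij]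

/-- A residue field of `E ⊗ M` at a maximal ideal. It is the place where the generic point of the
quadric and its points over `M` are compared. -/
theorem exists_common_extension {F : Type u} {E : Type v} {M : Type w} [Field F] [Field E] [Field M] (σ : F →+* E)
    (ρ : F →+* M) : ∃ (Ω : Type (max v w)) (_ : Field Ω) (α : E →+* Ω) (β : M →+* Ω),
      α.comp σ = β.comp ρ := by
  let := σ.toAlgebra
  let := ρ.toAlgebra
  obtain ⟨m, hm⟩ := Ideal.exists_maximal (E ⊗[F] M)
  refine ⟨(E ⊗[F] M) ⧸ m, Ideal.Quotient.field m,
    (Ideal.Quotient.mk m).comp Algebra.TensorProduct.includeLeftRingHom,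
    (Ideal.Quotient.mk m).comp Algebra.TensorProduct.includeRight.toRingHom, ?_⟩
  ext x
  change Ideal.Quotient.mk m (algebraMap F E x ⊗ₜ 1) = Ideal.Quotient.mk m (1 ⊗ₜ algebraMap F M x)
  rw [Algebra.algebraMap_eq_smul_one, Algebra.algebraMap_eq_smul_one, TensorProduct.smul_tmul]

/-- A multiple of the image of `t` under the reflection in the vector `w`. -/
def scaledReflection {R : Type*} [CommRing R] (G : Matrix ι ι R) (t w : ι → R) : ι → R :=
  (w ⬝ᵥ G *ᵥ w) • t - (2 * (t ⬝ᵥ G *ᵥ w)) • w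

theorem scaledReflection_map {R R' : Type*} [CommRing R] [CommRing R'] (ρ : R →+* R')
    (G : Matrix ι ι R) (t w : ι → R) :
    scaledReflection (G.map ρ) (ρ ∘ t) (ρ ∘ w) = ρ ∘ scaledReflection G t w := by
  ext i
  simp [scaledReflection, map_dotProduct_mulVec, map_ofNat ρ 2]

theorem scaledReflection_isotropic {R : Type*} [CommRing R] {G : Matrix ι ι R} (hG : G.IsSymm)
    {t : ι → R} (ht : t ⬝ᵥ G *ᵥ t = 0) (w : ι → R) :
    scaledReflection G t w ⬝ᵥ G *ᵥ scaledReflection G t w = 0 := by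
  simp only [scaledReflection, mulVec_sub, mulVec_smul, dotProduct_sub, sub_dotProduct,
    dotProduct_smul, smul_dotProduct, smul_eq_mul, ht, dotProduct_mulVec_comm hG w t]
  ring

/-- If `v` itself is orthogonal to `u`, reflect it in a vector `w` orthogonal to neither: the
pairing of `u` with the scaled reflection is `-2 B(v, w) B(u, w)`. -/
theorem exists_isotropic_not_orthogonal {M Ω : Type*} [Field M] [Field Ω] (β : M →+* Ω)
    (h2 : (2 : M) ≠ 0) [DecidableEq ι] {G : Matrix ι ι M} (hG : G.IsSymm) (hdet : G.det ≠ 0)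
    {v : ι → M} (hv : v ≠ 0) (hv0 : v ⬝ᵥ G *ᵥ v = 0) {u : ι → Ω} (hu : u ≠ 0) :
    ∃ t : ι → M, t ⬝ᵥ G *ᵥ t = 0 ∧ u ⬝ᵥ (G.map β) *ᵥ (β ∘ t) ≠ 0 := by
  by_cases huv : u ⬝ᵥ (G.map β) *ᵥ (β ∘ v) = 0
  swap
  · exact ⟨v, hv0, huv⟩
  have hG' : (G.map β).IsSymm := hG.map β
  have hdet' : (G.map β).det ≠ 0 := by
    rw [← RingHom.mapMatrix_apply, ← RingHom.map_det]
    exact (map_ne_zero β).2 hdet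
  obtain ⟨i, hi⟩ : ∃ i, (G *ᵥ v) i ≠ 0 := by
    by_contra! h
    exact hv (Matrix.eq_zero_of_mulVec_eq_zero hdet (funext h))
  obtain ⟨j, hj⟩ : ∃ j, (G.map β *ᵥ u) j ≠ 0 := by
    by_contra! h
    exact hu (Matrix.eq_zero_of_mulVec_eq_zero hdet' (funext h))
  -- Two proper hyperplanes do not cover the space: one of two basis vectors, or their sum, lies
  -- outside both.
  have hw : ∃ w : ι → M, v ⬝ᵥ G *ᵥ w ≠ 0 ∧ u ⬝ᵥ (G.map β) *ᵥ (β ∘ w) ≠ 0 := by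
    have hs : ∀ l, v ⬝ᵥ G *ᵥ (Pi.single l 1) = (G *ᵥ v) l := by
      intro l
      rw [dotProduct_mulVec_comm hG, single_one_dotProduct]
    have hc : ∀ l, β ∘ (Pi.single l 1 : ι → M) = Pi.single l 1 := by
      intro l
      ext m
      simp [Pi.single_apply, apply_ite β]
    have hs' : ∀ l, u ⬝ᵥ (G.map β) *ᵥ (β ∘ (Pi.single l 1 : ι → M)) = (G.map β *ᵥ u) l := by
      intro l
      rw [hc, dotProduct_mulVec_comm hG', single_one_dotProduct]
    by_cases h1 : (G.map β *ᵥ u) i = 0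
    · by_cases h3 : (G *ᵥ v) j = 0
      · refine ⟨Pi.single i 1 + Pi.single j 1, ?_, ?_⟩
        · rwa [mulVec_add, dotProduct_add, hs, hs, h3, add_zero]
        · have : β ∘ (Pi.single i 1 + Pi.single j 1 : ι → M) =
            β ∘ (Pi.single i 1) + β ∘ (Pi.single j 1) := by
            ext; simp
          rwa [this, mulVec_add, dotProduct_add, hs', hs', h1, zero_add]
      · exact ⟨Pi.single j 1, by rwa [hs], by rwa [hs']⟩
    · exact ⟨Pi.single i 1, by rwa [hs], by rwa [hs']⟩
  obtain ⟨w, hw1, hw2⟩ := hw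
  refine ⟨scaledReflection G v w, scaledReflection_isotropic hG hv0 w, ?_⟩
  rw [← scaledReflection_map, scaledReflection, mulVec_sub, mulVec_smul, mulVec_smul,
    dotProduct_sub, dotProduct_smul, dotProduct_smul, huv, map_dotProduct_mulVec,
    map_dotProduct_mulVec, smul_zero, zero_sub, smul_eq_mul]
  refine neg_ne_zero.2 (mul_ne_zero (mul_ne_zero ?_ ((map_ne_zero β).2 hw1)) hw2)
  rw [← map_ofNat β 2]
  exact (map_ne_zero β).2 h2

/-- The multiples of the images of `t` under reflections, as polynomials in the scalar and in the
coordinates of the reflecting vector. -/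
def isotropicFamily {R : Type*} [CommRing R] (G : Matrix ι ι R) (t : ι → R) (i : ι) :
    MvPolynomial (Option ι) R :=
  MvPolynomial.X none * scaledReflection (G.map MvPolynomial.C) (MvPolynomial.C ∘ t)
    (fun i => MvPolynomial.X (some i)) i

theorem eval₂Hom_isotropicFamily {R R' : Type*} [CommRing R] [CommRing R'] (γ : R →+* R')
    (G : Matrix ι ι R) (t : ι → R) (z : Option ι → R') (i : ι) :
    MvPolynomial.eval₂Hom γ z (isotropicFamily G t i) =
      z none * scaledReflection (G.map γ) (γ ∘ t) (fun i => z (some i)) i := by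
  have e1 : (G.map MvPolynomial.C).map (MvPolynomial.eval₂Hom γ z) = G.map γ := by
    ext; simp
  have e2 : MvPolynomial.eval₂Hom γ z ∘ MvPolynomial.C ∘ t = γ ∘ t := by
    ext; simp
  have e3 : (MvPolynomial.eval₂Hom γ z ∘ fun i => MvPolynomial.X (some i)) =
      fun i => z (some i) := by
    ext; simp
  rw [isotropicFamily, ← e1, ← e2, ← e3, scaledReflection_map, map_mul]
  simp

/-- Scaled reflections of a fixed isotropic `t` parametrize isotropic vectors by polynomials over
`M`. If `f` vanished at all isotropic vectors over `M`, its pullback along the parametrization would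
be the zero polynomial, `M` being infinite, and `f` would vanish at `u`, which the parametrization
reaches over `Ω`. -/
theorem exists_isotropic_eval_ne_zero {M Ω : Type*} [Field M] [Infinite M] [Field Ω]
    (β : M →+* Ω) (h2 : (2 : M) ≠ 0) [DecidableEq ι] {G : Matrix ι ι M} (hG : G.IsSymm)
    (hdet : G.det ≠ 0) (hiso : IsIsotropic G) {u : ι → Ω} (hu : u ≠ 0)
    (hu0 : u ⬝ᵥ (G.map β) *ᵥ u = 0) (f : MvPolynomial ι M)
    (hf : MvPolynomial.eval₂Hom β u f ≠ 0) :
    ∃ v : ι → M, v ⬝ᵥ G *ᵥ v = 0 ∧ MvPolynomial.eval v f ≠ 0 := by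
  obtain ⟨v, hv, hv0⟩ := hiso
  obtain ⟨t, ht0, htu⟩ := exists_isotropic_not_orthogonal β h2 hG hdet hv hv0 hu
  have hG' : (G.map β).IsSymm := hG.map β
  by_contra! hall
  have hzero : MvPolynomial.bind₁ (isotropicFamily G t) f = 0 := by
    refine MvPolynomial.funext fun z => ?_
    have h1 := MvPolynomial.eval₂Hom_bind₁ (RingHom.id M) z (isotropicFamily G t) f
    rw [map_zero]
    refine h1.trans (hall _ ?_)
    have e : (fun i => MvPolynomial.eval₂Hom (RingHom.id M) z (isotropicFamily G t i)) =
        z none • scaledReflection G t (fun i => z (some i)) := by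
      ext i
      rw [eval₂Hom_isotropicFamily]
      simp [RingHom.coe_id]
    rw [e, mulVec_smul, dotProduct_smul, smul_dotProduct, scaledReflection_isotropic hG ht0]
    simp
  let c : Ω := -(2 * (u ⬝ᵥ (G.map β) *ᵥ (β ∘ t)))
  have h2' : (2 : Ω) ≠ 0 := by
    rw [← map_ofNat β 2]
    exact (map_ne_zero β).2 h2
  have hc : c ≠ 0 := neg_ne_zero.2 (mul_ne_zero h2' htu)
  -- Reflection in `u - t` exchanges the isotropic vectors `t` and `u`; its scaled version sends `t`
  -- to `c • u`, hence the scalar `c⁻¹`.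
  let z : Option ι → Ω := fun o => o.elim c⁻¹ (u - β ∘ t)
  have e : (fun i => MvPolynomial.eval₂Hom β z (isotropicFamily G t i)) = u := by
    ext i
    rw [eval₂Hom_isotropicFamily]
    have ht' : (β ∘ t) ⬝ᵥ (G.map β) *ᵥ (β ∘ t) = 0 := by
      rw [map_dotProduct_mulVec, ht0, map_zero]
    have e1 : scaledReflection (G.map β) (β ∘ t) (u - β ∘ t) = c • u := by
      simp only [scaledReflection, mulVec_sub, dotProduct_sub, sub_dotProduct, ht', hu0,
        dotProduct_mulVec_comm hG' (β ∘ t) u, c]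
      ext i
      simp only [Pi.sub_apply, Pi.smul_apply, smul_eq_mul]
      ring
    change c⁻¹ * scaledReflection (G.map β) (β ∘ t) (u - β ∘ t) i = u i
    rw [e1, Pi.smul_apply, smul_eq_mul, inv_mul_cancel_left₀ hc]
  have h3 := MvPolynomial.eval₂Hom_bind₁ β z (isotropicFamily G t) f
  rw [hzero, map_zero, e] at h3
  exact hf h3.symm

end Specialization

/-! ### The function field as a generic field of isotropy -/

section FunctionField

variable {F : Type u} [Field F] [Invertible (2 : F)] {V : Type v} [AddCommGroup V] [Module F V]
  [FiniteDimensional F V]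

theorem toPolynomial_eq_dotProduct (p : QuadraticForm F V) :
    toPolynomial p = (fun i => MvPolynomial.X i) ⬝ᵥ
      (gram p (Module.finBasis F V)).map MvPolynomial.C *ᵥ (fun i => MvPolynomial.X i) := by
  simp only [toPolynomial, dotProduct, mulVec, Finset.mul_sum, gram, Matrix.map_apply,
    Matrix.of_apply]
  exact Finset.sum_congr rfl fun i _ => Finset.sum_congr rfl fun j _ => by ring

theorem eval₂Hom_toPolynomial {R : Type*} [CommRing R] (ρ : F →+* R) (p : QuadraticForm F V)
    (x : Fin (Module.finrank F V) → R) :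
    MvPolynomial.eval₂Hom ρ x (toPolynomial p) =
      x ⬝ᵥ (gram p (Module.finBasis F V)).map ρ *ᵥ x := by
  have e1 : ((gram p (Module.finBasis F V)).map MvPolynomial.C).map
      (MvPolynomial.eval₂Hom ρ x) = (gram p (Module.finBasis F V)).map ρ := by
    ext; simp
  have e2 : (MvPolynomial.eval₂Hom ρ x ∘ fun i => MvPolynomial.X i) = x := by
    ext; simp
  rw [toPolynomial_eq_dotProduct, ← map_dotProduct_mulVec, e1, e2]

theorem toPolynomial_isHomogeneous (p : QuadraticForm F V) :
    (toPolynomial p).IsHomogeneous 2 :=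
  MvPolynomial.IsHomogeneous.sum _ _ _ fun _ _ => MvPolynomial.IsHomogeneous.sum _ _ _ fun _ _ =>
    (MvPolynomial.isHomogeneous_C_mul_X _ _).mul (MvPolynomial.isHomogeneous_X _ _)

/-- By degrees: a nonzero multiple of a quadratic polynomial has degree at least two. Hence the
generic point is nonzero. -/
theorem not_toPolynomial_dvd_X (p : QuadraticForm F V) (i : Fin (Module.finrank F V)) :
    ¬ toPolynomial p ∣ MvPolynomial.X i := by
  rintro ⟨h, hh⟩
  have hX : (MvPolynomial.X i : MvPolynomial (Fin (Module.finrank F V)) F) ≠ 0 :=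
    MvPolynomial.X_ne_zero i
  have hp0 : toPolynomial p ≠ 0 := by
    intro h0
    rw [h0, zero_mul] at hh
    exact hX hh
  have hh0 : h ≠ 0 := by
    intro h0
    rw [h0, mul_zero] at hh
    exact hX hh
  have h1 := congrArg MvPolynomial.totalDegree hh
  rw [MvPolynomial.totalDegree_X, MvPolynomial.totalDegree_mul_of_isDomain hp0 hh0,
    (toPolynomial_isHomogeneous p).totalDegree hp0] at h1
  omega

/-- The homomorphism from the polynomial ring to the function field. -/
def toFunctionField (p : QuadraticForm F V) :
    MvPolynomial (Fin (Module.finrank F V)) F →+* FunctionField p :=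
  (algebraMap (MvPolynomial (Fin (Module.finrank F V)) F ⧸ functionIdeal p)
    (FractionRing (MvPolynomial (Fin (Module.finrank F V)) F ⧸ functionIdeal p))).comp
    (Ideal.Quotient.mk _)

theorem toFunctionField_C (p : QuadraticForm F V) (a : F) :
    toFunctionField p (MvPolynomial.C a) = algebraMap F (FunctionField p) a := rfl

theorem toFunctionField_eq_zero_iff (p : QuadraticForm F V) (hp : Irreducible (toPolynomial p))
    (f : MvPolynomial (Fin (Module.finrank F V)) F) :
    toFunctionField p f = 0 ↔ toPolynomial p ∣ f := by
  have h : toFunctionField p f = 0 ↔ Ideal.Quotient.mk (functionIdeal p) f = 0 :=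
    IsFractionRing.to_map_eq_zero_iff
      (R := MvPolynomial (Fin (Module.finrank F V)) F ⧸ functionIdeal p)
      (K := FractionRing (MvPolynomial (Fin (Module.finrank F V)) F ⧸ functionIdeal p))
  rw [h, Ideal.Quotient.eq_zero_iff_mem, functionIdeal, if_pos hp, Ideal.mem_span_singleton]

/-- The generic point of the quadric. -/
def genericPoint (p : QuadraticForm F V) (i : Fin (Module.finrank F V)) : FunctionField p :=
  toFunctionField p (MvPolynomial.X i)

theorem eval₂Hom_genericPoint {Ω : Type*} [Field Ω] (p : QuadraticForm F V)
    (α : FunctionField p →+* Ω) (f : MvPolynomial (Fin (Module.finrank F V)) F) :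
    MvPolynomial.eval₂Hom (α.comp (algebraMap F (FunctionField p))) (α ∘ genericPoint p) f =
      α (toFunctionField p f) := by
  have : MvPolynomial.eval₂Hom (α.comp (algebraMap F (FunctionField p))) (α ∘ genericPoint p) =
      α.comp (toFunctionField p) := by
    refine MvPolynomial.ringHom_ext (fun a => ?_) fun i => ?_
    · simp [toFunctionField_C]
    · simp [genericPoint]
  rw [this, RingHom.comp_apply]

omit [FiniteDimensional F V] in
theorem isIsotropic_gram_iff {ι : Type*} [Fintype ι] (p : QuadraticForm F V)
    (b : Module.Basis ι F V) : IsIsotropic (gram p b) ↔ ∃ v, v ≠ 0 ∧ p v = 0 := by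
  constructor
  · rintro ⟨x, hx, h0⟩
    refine ⟨b.equivFun.symm x, ?_, by rwa [← dotProduct_gram_mulVec_self]⟩
    rwa [Ne, LinearEquiv.map_eq_zero_iff]
  · rintro ⟨v, hv, h0⟩
    refine ⟨b.equivFun v, ?_, by
      rwa [dotProduct_gram_mulVec_self, LinearEquiv.symm_apply_apply]⟩
    rwa [Ne, LinearEquiv.map_eq_zero_iff]

theorem genericPoint_ne_zero (p : QuadraticForm F V) (hp : Irreducible (toPolynomial p))
    (hd : 2 ≤ Module.finrank F V) : genericPoint p ≠ 0 := by
  intro h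
  have := congrFun h ⟨0, by omega⟩
  rw [genericPoint, Pi.zero_apply, toFunctionField_eq_zero_iff p hp] at this
  exact not_toPolynomial_dvd_X p _ this

theorem genericPoint_isotropic (p : QuadraticForm F V) (hp : Irreducible (toPolynomial p)) :
    genericPoint p ⬝ᵥ (gram p (Module.finBasis F V)).map (algebraMap F (FunctionField p)) *ᵥ
      genericPoint p = 0 := by
  have h1 := eval₂Hom_genericPoint p (RingHom.id _) (toPolynomial p)
  rw [(toFunctionField_eq_zero_iff p hp _).2 dvd_rfl, map_zero, eval₂Hom_toPolynomial] at h1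
  exact h1

theorem isIsotropic_functionField (p : QuadraticForm F V) (hp : p.Nondegenerate)
    (hd : 2 ≤ Module.finrank F V) :
    IsIsotropic ((gram p (Module.finBasis F V)).map (algebraMap F (FunctionField p))) := by
  by_cases hirr : Irreducible (toPolynomial p)
  · exact ⟨genericPoint p, genericPoint_ne_zero p hirr hd, genericPoint_isotropic p hirr⟩
  · refine IsIsotropic.map ?_ _
    rw [isIsotropic_gram_iff]
    rw [irreducible_toPolynomial_iff p hp hd, not_not] at hirr
    obtain ⟨e⟩ := hirr
    -- In the reducible case `p` is a hyperbolic plane, already isotropic over `F`.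
    refine ⟨e.symm ![1, 1], fun h => ?_, ?_⟩
    · have h1 : (![1, 1] : Fin 2 → F) = 0 := (LinearEquiv.map_eq_zero_iff e.symm.toLinearEquiv).1 h
      simpa using congrFun h1 0
    · rw [e.symm.map_app, hyperbolicPlane_apply]
      simp

variable {κ : Type*} [Fintype κ]

/-- The frame lives over the coordinate ring of the quadric with one denominator `f` inverted. Since
`f` does not vanish at the generic point, some isotropic `v` over `M` has `f(v) ≠ 0`, and evaluation
at `v` specializes the frame. -/
theorem HasIsotropicFrame.specialize_of_infinite (p : QuadraticForm F V) (hp : p.Nondegenerate)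
    (hd : 2 ≤ Module.finrank F V) {S : Matrix κ κ F} {k : ℕ}
    (h : HasIsotropicFrame (S.map (algebraMap F (FunctionField p))) k)
    {M : Type w} [Field M] [Infinite M] (ρ : F →+* M)
    (hiso : IsIsotropic ((gram p (Module.finBasis F V)).map ρ)) :
    HasIsotropicFrame (S.map ρ) k := by
  by_cases hirr : Irreducible (toPolynomial p)
  swap
  · let e := RingEquiv.ofBijective _ (algebraMap_functionField_bijective p hirr)
    have h1 := h.map (ρ.comp e.symm.toRingHom)
    rw [Matrix.map_map] at h1
    convert h1 using 2
    ext a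
    exact congrArg ρ (e.symm_apply_apply a).symm
  let I := functionIdeal p
  let R := MvPolynomial (Fin (Module.finrank F V)) F ⧸ I
  let E := FractionRing R
  obtain ⟨s, hs, hspec⟩ := HasIsotropicFrame.exists_denominator.{w} (R := R) (E := E)
    (S := S.map (algebraMap F R)) (k := k) (by rw [Matrix.map_map]; exact h)
  obtain ⟨f, rfl⟩ := Ideal.Quotient.mk_surjective s
  obtain ⟨Ω, _, α, β, hαβ⟩ := exists_common_extension (algebraMap F (FunctionField p)) ρ
  have h2 : (2 : M) ≠ 0 := by
    rw [← map_ofNat ρ 2]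
    exact (map_ne_zero ρ).2 (Invertible.ne_zero 2)
  let G := gram p (Module.finBasis F V)
  have hdet : (G.map ρ).det ≠ 0 := by
    rw [← RingHom.mapMatrix_apply, ← RingHom.map_det]
    exact (map_ne_zero ρ).2 ((nondegenerate_iff_det_gram_ne_zero p _).1 hp)
  have hu : α ∘ genericPoint p ≠ 0 := by
    intro h0
    refine genericPoint_ne_zero p hirr hd (funext fun i => α.injective ?_)
    rw [Pi.zero_apply, map_zero]
    exact congrFun h0 i
  have hG : (G.map ρ).map β = (G.map (algebraMap F (FunctionField p))).map α := by
    rw [Matrix.map_map, Matrix.map_map, ← RingHom.coe_comp, ← RingHom.coe_comp, hαβ]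
  obtain ⟨v, hv0, hv⟩ := exists_isotropic_eval_ne_zero β h2 ((gram_isSymm p _).map ρ) hdet hiso hu
    (by rw [hG, map_dotProduct_mulVec, genericPoint_isotropic p hirr, map_zero])
    (MvPolynomial.map ρ f) (by
      have e := eval₂Hom_genericPoint p α f
      rw [hαβ] at e
      rw [MvPolynomial.coe_eval₂Hom, MvPolynomial.eval₂_map]
      rw [MvPolynomial.coe_eval₂Hom] at e
      rw [e, Ne, map_eq_zero, toFunctionField_eq_zero_iff p hirr]
      rwa [Ne, Ideal.Quotient.eq_zero_iff_mem, show I = functionIdeal p from rfl, functionIdeal,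
        if_pos hirr, Ideal.mem_span_singleton] at hs)
  let φ : R →+* M := Ideal.Quotient.lift I (MvPolynomial.eval₂Hom ρ v) fun g hg => by
    rw [show I = functionIdeal p from rfl, functionIdeal, if_pos hirr,
      Ideal.mem_span_singleton] at hg
    obtain ⟨g, rfl⟩ := hg
    rw [map_mul, eval₂Hom_toPolynomial, hv0, zero_mul]
  have h1 := hspec M φ (by
    rw [MvPolynomial.eval_map] at hv
    exact hv)
  rw [Matrix.map_map] at h1
  convert h1 using 2
  ext a
  exact (MvPolynomial.eval₂_C ρ v a).symm

/-- Make the frame integral over `M[[x]]` and set `x = 0`. -/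
theorem hasIsotropicFrame_of_laurentSeries {M : Type*} [Field M] {S : Matrix κ κ M} {k : ℕ}
    (h : HasIsotropicFrame (S.map (algebraMap M M⸨X⸩)) k) : HasIsotropicFrame S k := by
  have h1 : HasIsotropicFrame ((S.map (PowerSeries.C (R := M))).map
      (algebraMap (PowerSeries M) M⸨X⸩)) k := by
    rw [Matrix.map_map]
    convert h using 2
    ext a : 1
    change ((PowerSeries.C a : PowerSeries M) : M⸨X⸩) = algebraMap M M⸨X⸩ a
    rw [PowerSeries.coe_C, LaurentSeries.algebraMap_apply]
  have h2 := (hasIsotropicFrame_of_fractionRing h1).map (PowerSeries.constantCoeff (R := M))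
  rw [Matrix.map_map] at h2
  convert h2
  ext i j
  simp

theorem infinite_laurentSeries (M : Type*) [Field M] : Infinite M⸨X⸩ :=
  Infinite.of_injective (fun n : ℕ => (HahnSeries.single (n : ℤ) (1 : M) : M⸨X⸩)) fun m n h => by
    by_contra hmn
    have h1 := congrArg (fun x : M⸨X⸩ => x.coeff (m : ℤ)) h
    simp [HahnSeries.coeff_single_of_ne (show (m : ℤ) ≠ n by exact_mod_cast hmn)] at h1

/-- Passing to the infinite field `M((x))` and back covers finite `M`. -/
theorem HasIsotropicFrame.specialize (p : QuadraticForm F V) (hp : p.Nondegenerate)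
    (hd : 2 ≤ Module.finrank F V) {S : Matrix κ κ F} {k : ℕ}
    (h : HasIsotropicFrame (S.map (algebraMap F (FunctionField p))) k)
    {M : Type w} [Field M] (ρ : F →+* M)
    (hiso : IsIsotropic ((gram p (Module.finBasis F V)).map ρ)) :
    HasIsotropicFrame (S.map ρ) k := by
  have := infinite_laurentSeries M
  refine hasIsotropicFrame_of_laurentSeries ?_
  rw [Matrix.map_map, ← RingHom.coe_comp]
  refine h.specialize_of_infinite p hp hd _ ?_
  rw [RingHom.coe_comp, ← Matrix.map_map]
  exact hiso.map _

/-- Over every extension of `F` over which the form with matrix `G` is isotropic, the form with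
matrix `S` has a totally isotropic subspace of dimension `k`. -/
def IsotropyForces {F : Type u} [Field F] {ι κ : Type*} [Fintype ι] [Fintype κ]
    (G : Matrix ι ι F) (S : Matrix κ κ F) (k : ℕ) : Prop :=
  ∀ (M : Type u) [Field M] (ρ : F →+* M), IsIsotropic (G.map ρ) → HasIsotropicFrame (S.map ρ) k

theorem isotropyForces_iff (p : QuadraticForm F V) (hp : p.Nondegenerate)
    (hd : 2 ≤ Module.finrank F V) (S : Matrix κ κ F) (k : ℕ) :
    IsotropyForces (gram p (Module.finBasis F V)) S k ↔
      HasIsotropicFrame (S.map (algebraMap F (FunctionField p))) k :=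
  ⟨fun h => h _ _ (isIsotropic_functionField p hp hd), fun h _ _ ρ hρ => h.specialize p hp hd ρ hρ⟩

omit [FiniteDimensional F V] in
theorem gram_toMatrix {ι ι' : Type*} [Fintype ι] [Fintype ι'] (p : QuadraticForm F V)
    (b : Module.Basis ι F V) (b' : Module.Basis ι' F V) :
    gram p b' = (b.toMatrix b')ᵀ * gram p b * b.toMatrix b' := by
  classical
  ext i j
  have e : ∀ j, b.equivFun.symm (fun i => b.toMatrix b' i j) = b' j := by
    intro j
    rw [LinearEquiv.symm_apply_eq]
    ext i
    rfl
  have : ((b.toMatrix b')ᵀ * gram p b * b.toMatrix b') i j =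
      (fun l => b.toMatrix b' l i) ⬝ᵥ gram p b *ᵥ (fun l => b.toMatrix b' l j) := by
    rw [dotProduct_mulVec]
    rfl
  rw [this, dotProduct_gram_mulVec, e, e]
  rfl

omit [FiniteDimensional F V] in
theorem IsIsotropic.of_basis {ι ι' : Type*} [Fintype ι] [Fintype ι'] (p : QuadraticForm F V)
    (b : Module.Basis ι F V) (b' : Module.Basis ι' F V) {M : Type*} [Field M] (ρ : F →+* M)
    (h : IsIsotropic ((gram p b').map ρ)) : IsIsotropic ((gram p b).map ρ) := by
  classical
  obtain ⟨v, hv, h0⟩ := h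
  refine ⟨(b.toMatrix b').map ρ *ᵥ v, fun hz => hv ?_, ?_⟩
  · have h1 := congrArg ((b'.toMatrix b).map ρ *ᵥ ·) hz
    simp only [mulVec_mulVec, ← Matrix.map_mul, Module.Basis.toMatrix_mul_toMatrix_flip,
      mulVec_zero] at h1
    rwa [Matrix.map_one _ (map_zero ρ) (map_one ρ), one_mulVec] at h1
  · rw [gram_toMatrix p b b', Matrix.map_mul, Matrix.map_mul, ← mulVec_mulVec, ← mulVec_mulVec,
      dotProduct_mulVec, Matrix.transpose_map, vecMul_transpose] at h0
    exact h0

omit [FiniteDimensional F V] in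
theorem IsotropyForces.of_basis {ι ι' : Type*} [Fintype ι] [Fintype ι'] (p : QuadraticForm F V)
    (b : Module.Basis ι F V) (b' : Module.Basis ι' F V) {S : Matrix κ κ F} {k : ℕ}
    (h : IsotropyForces (gram p b) S k) : IsotropyForces (gram p b') S k :=
  fun M _ ρ hρ => h M ρ (hρ.of_basis p b b' ρ)

end FunctionField

/-! ### Multiplication by `⟨1, -x⟩` doubles the forced isotropic dimension -/

section Doubling

variable {ι κ : Type*} [Fintype ι] [Fintype κ]

theorem HasIsotropicFrame.mono {K : Type*} [Field K] (h2 : (2 : K) ≠ 0) {S : Matrix ι ι K}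
    (hS : S.IsSymm) {k j : ℕ} (h : HasIsotropicFrame S k) (hj : j ≤ k) :
    HasIsotropicFrame S j := by
  obtain ⟨f, hf, h0⟩ := h.exists_linearMap
  exact hasIsotropicFrame_of_linearMap h2 hS f hf h0 (by rwa [Module.finrank_fin_fun])

/-- The matrix of `⟨1, -x⟩ ⊗ S`. -/
def twist {R : Type*} [CommRing R] (x : R) (S : Matrix ι ι R) :
    Matrix (Fin 2 × ι) (Fin 2 × ι) R :=
  diagonal ![1, -x] ⊗ₖ S

omit [Fintype ι] in
theorem twist_map {R R' : Type*} [CommRing R] [CommRing R'] (ρ : R →+* R') (x : R)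
    (S : Matrix ι ι R) : (twist x S).map ρ = twist (ρ x) (S.map ρ) := by
  ext ⟨a, i⟩ ⟨b, j⟩
  fin_cases a <;> fin_cases b <;> simp [twist]

omit [Fintype ι] in
theorem twist_isSymm {R : Type*} [CommRing R] (x : R) {S : Matrix ι ι R} (hS : S.IsSymm) :
    (twist x S).IsSymm := by
  ext ⟨a, i⟩ ⟨b, j⟩
  fin_cases a <;> fin_cases b <;> simp [twist, hS.apply i j]

theorem dotProduct_twist_mulVec {R : Type*} [CommRing R] (x : R) (S : Matrix ι ι R)
    (v : Fin 2 × ι → R) :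
    v ⬝ᵥ twist x S *ᵥ v = (fun i => v (0, i)) ⬝ᵥ S *ᵥ (fun i => v (0, i)) -
      x * ((fun i => v (1, i)) ⬝ᵥ S *ᵥ (fun i => v (1, i))) := by
  simp [dotProduct, mulVec, twist, Fintype.sum_prod_type, Fin.sum_univ_two, Finset.mul_sum, sub_eq_add_neg]
  refine Finset.sum_congr rfl fun i _ => Finset.sum_congr rfl fun j _ => by ring

/-- Each coordinate `a + bω` of `u` is sent to the pair of the `ω`-components of
`(s + τω)(a + bω)` and of `a + bω`. -/
def normMap {E : Type*} [Field E] (d s τ : E) :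
    (κ → QuadraticAlgebra E d 0) →ₗ[E] (Fin 2 × κ → E) where
  toFun u ai := ![s * (u ai.2).im + τ * (u ai.2).re, (u ai.2).im] ai.1
  map_add' u v := by
    ext ⟨a, i⟩
    fin_cases a
    · simp; ring
    · simp
  map_smul' c u := by
    ext ⟨a, i⟩
    fin_cases a
    · simp; ring
    · simp

theorem dotProduct_quadraticAlgebra {E : Type*} [Field E] (d : E) {S : Matrix κ κ E}
    (hS : S.IsSymm) (u : κ → QuadraticAlgebra E d 0) :
    u ⬝ᵥ S.map (algebraMap E (QuadraticAlgebra E d 0)) *ᵥ u =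
      ⟨(fun i => (u i).re) ⬝ᵥ S *ᵥ (fun i => (u i).re) +
        d * ((fun i => (u i).im) ⬝ᵥ S *ᵥ (fun i => (u i).im)),
        2 * ((fun i => (u i).re) ⬝ᵥ S *ᵥ (fun i => (u i).im))⟩ := by
  have hu : u = algebraMap E (QuadraticAlgebra E d 0) ∘ (fun i => (u i).re) +
      (⟨0, 1⟩ : QuadraticAlgebra E d 0) • (algebraMap E (QuadraticAlgebra E d 0) ∘
        fun i => (u i).im) := by
    ext i <;> simp
  conv_lhs => rw [hu]
  simp only [mulVec_add, mulVec_smul, dotProduct_add, add_dotProduct, dotProduct_smul,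
    smul_dotProduct, map_dotProduct_mulVec, dotProduct_mulVec_comm hS (fun i => (u i).im)
    (fun i => (u i).re), smul_eq_mul]
  ext
  · simp
  · simp
    ring

/-- An isotropic `a + bω` means `S(a) = -d S(b)` and `S(a, b) = 0`, so `S(s b + τ a) = (s² - d τ²)
S(b)`: the pair `(s b + τ a, b)` is isotropic for the twisted form. As `τ ≠ 0`, the pair determines
`a + bω`, and the dimension over `E` is twice that over `E(ω)`. -/
theorem hasIsotropicFrame_twist_of_norm {E : Type*} [Field E] (h2 : (2 : E) ≠ 0) {d s τ : E}
    [Fact (∀ r : E, r ^ 2 ≠ d + 0 * r)] (hτ : τ ≠ 0) {S : Matrix κ κ E} (hS : S.IsSymm) {k : ℕ}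
    (h : HasIsotropicFrame (S.map (algebraMap E (QuadraticAlgebra E d 0))) k) :
    HasIsotropicFrame (twist (s ^ 2 - d * τ ^ 2) S) (2 * k) := by
  obtain ⟨f, hf, h0⟩ := h.exists_linearMap
  have hfin : Module.finrank E (Fin k → QuadraticAlgebra E d 0) = 2 * k := by
    rw [Module.finrank_pi_fintype]
    simp [QuadraticAlgebra.finrank_eq_two, mul_comm]
  refine hasIsotropicFrame_of_linearMap h2 (twist_isSymm _ hS)
    (normMap d s τ ∘ₗ f.restrictScalars E) ?_ (fun x => ?_) hfin.ge
  · refine Function.Injective.comp (g := normMap d s τ) ?_ hf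
    rw [← LinearMap.ker_eq_bot, eq_bot_iff]
    intro u hu
    rw [Submodule.mem_bot]
    ext i
    · have e1 : s * (u i).im + τ * (u i).re = 0 := congrFun (LinearMap.mem_ker.1 hu) (0, i)
      have e2 : (u i).im = 0 := congrFun (LinearMap.mem_ker.1 hu) (1, i)
      rw [e2, mul_zero, zero_add] at e1
      exact (mul_eq_zero.1 e1).resolve_left hτ
    · exact congrFun (LinearMap.mem_ker.1 hu) (1, i)
  · have e := h0 x
    rw [dotProduct_quadraticAlgebra d hS] at e
    rw [dotProduct_twist_mulVec]
    set u := f x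
    have e1 := congrArg QuadraticAlgebra.re e
    have e2 := congrArg QuadraticAlgebra.im e
    simp only [QuadraticAlgebra.re_zero, QuadraticAlgebra.im_zero] at e1 e2
    have c0 : (fun i => (normMap d s τ ∘ₗ f.restrictScalars E) x (0, i)) =
      s • (fun i => (u i).im) + τ • (fun i => (u i).re) := rfl
    have c1 : (fun i => (normMap d s τ ∘ₗ f.restrictScalars E) x (1, i)) =
      (fun i => (u i).im) := rfl
    rw [c0, c1]
    simp only [mulVec_add, mulVec_smul, dotProduct_add, add_dotProduct, dotProduct_smul,
      smul_dotProduct, dotProduct_mulVec_comm hS (fun i => (u i).im)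
      (fun i => (u i).re), smul_eq_mul]
    linear_combination τ ^ 2 * e1 + s * τ * e2

/-- The plane spanned by `a` and `b` has determinant `-d`. Completing the square, it has an
isotropic vector exactly over fields where `d` is a square; anisotropy thus makes `d` a nonsquare.
-/
theorem exists_isotropic_quadraticExtension {E : Type*} [Field E] {G : Matrix ι ι E}
    (hG : G.IsSymm) (han : ¬ IsIsotropic G) {a b : ι → E} (hb : b ≠ 0)
    (hab : ∀ c : E, a ≠ c • b) :
    ∃ d, d = (a ⬝ᵥ G *ᵥ b) ^ 2 - (a ⬝ᵥ G *ᵥ a) * (b ⬝ᵥ G *ᵥ b) ∧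
      Fact (∀ r : E, r ^ 2 ≠ d + 0 * r) ∧
      IsIsotropic (G.map (algebraMap E (QuadraticAlgebra E d 0))) := by
  have hGb : b ⬝ᵥ G *ᵥ b ≠ 0 := fun h => han ⟨b, hb, h⟩
  obtain ⟨d, hd⟩ : ∃ d, d = (a ⬝ᵥ G *ᵥ b) ^ 2 - (a ⬝ᵥ G *ᵥ a) * (b ⬝ᵥ G *ᵥ b) := ⟨_, rfl⟩
  refine ⟨d, hd, ?_, ?_⟩
  · refine ⟨fun r hr => ?_⟩
    refine han ⟨(b ⬝ᵥ G *ᵥ b) • a - (a ⬝ᵥ G *ᵥ b - r) • b, fun h => ?_, ?_⟩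
    · refine hab ((b ⬝ᵥ G *ᵥ b)⁻¹ * (a ⬝ᵥ G *ᵥ b - r)) ?_
      rw [mul_smul, ← sub_eq_zero.1 h, smul_smul, inv_mul_cancel₀ hGb, one_smul]
    · simp only [mulVec_sub, mulVec_smul, dotProduct_sub, sub_dotProduct, dotProduct_smul,
        smul_dotProduct, smul_eq_mul, dotProduct_mulVec_comm hG b a]
      rw [hd] at hr
      linear_combination (b ⬝ᵥ G *ᵥ b) * hr
  · refine ⟨fun i => ⟨(b ⬝ᵥ G *ᵥ b) * a i - (a ⬝ᵥ G *ᵥ b) * b i, b i⟩, fun h => hb ?_, ?_⟩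
    · ext i
      exact congrArg QuadraticAlgebra.im (congrFun h i)
    · rw [dotProduct_quadraticAlgebra d hG]
      have c0 : (fun i => (b ⬝ᵥ G *ᵥ b) * a i - (a ⬝ᵥ G *ᵥ b) * b i) =
        (b ⬝ᵥ G *ᵥ b) • a - (a ⬝ᵥ G *ᵥ b) • b := rfl
      simp only [c0, mulVec_sub, mulVec_smul, dotProduct_sub, sub_dotProduct, dotProduct_smul,
        smul_dotProduct, smul_eq_mul, dotProduct_mulVec_comm hG b a]
      ext
      · simp only [QuadraticAlgebra.re_zero, hd]; ring
      · simp only [QuadraticAlgebra.im_zero]; ring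

theorem exists_ne_smul {E : Type*} [Field E] (hι : 2 ≤ Fintype.card ι) {b : ι → E} (hb : b ≠ 0) :
    ∃ a : ι → E, ∀ c : E, a ≠ c • b := by
  classical
  obtain ⟨i, hi⟩ := Function.ne_iff.1 hb
  obtain ⟨j, hj⟩ := Fintype.exists_ne_of_one_lt_card (by omega : 1 < Fintype.card ι) i
  refine ⟨Pi.single j 1, fun c hc => ?_⟩
  have h1 := congrFun hc i
  have h3 := congrFun hc j
  rw [Pi.single_eq_of_ne hj.symm, Pi.smul_apply, smul_eq_mul] at h1
  rw [Pi.single_eq_same, (mul_eq_zero.1 h1.symm).resolve_right hi, zero_smul] at h3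
  exact one_ne_zero h3

theorem IsotropyForces.hasIsotropicFrame_twist {E : Type u} [Field E] (h2 : (2 : E) ≠ 0)
    {G : Matrix ι ι E} (hG : G.IsSymm) (hι : 2 ≤ Fintype.card ι) {S : Matrix κ κ E}
    (hS : S.IsSymm) {x : E} (hx : x ≠ 0) {k : ℕ} (h : IsotropyForces G S k)
    (hiso : IsIsotropic (twist x G)) : HasIsotropicFrame (twist x S) (2 * k) := by
  by_cases hGi : IsIsotropic G
  · have h1 : HasIsotropicFrame S k := h E (RingHom.id E) hGi
    obtain ⟨f, hf, h0⟩ := h1.exists_linearMap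
    let g : (Fin 2 → Fin k → E) →ₗ[E] (Fin 2 × κ → E) :=
      LinearMap.pi fun ai => LinearMap.proj ai.2 ∘ₗ f ∘ₗ LinearMap.proj ai.1
    refine hasIsotropicFrame_of_linearMap h2 (twist_isSymm _ hS) g (fun y z hyz => ?_)
      (fun y => ?_)
      (by rw [Module.finrank_pi_fintype]; simp)
    · ext a : 1
      exact hf (funext fun i => congrFun hyz (a, i))
    · rw [dotProduct_twist_mulVec]
      change f (y 0) ⬝ᵥ S *ᵥ f (y 0) - x * (f (y 1) ⬝ᵥ S *ᵥ f (y 1)) = 0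
      rw [h0, h0, mul_zero, sub_zero]
  · obtain ⟨v, hv, h0⟩ := hiso
    rw [dotProduct_twist_mulVec] at h0
    set a : ι → E := fun i => v (0, i) with ha
    set b : ι → E := fun i => v (1, i) with hb
    have hb0 : b ≠ 0 := by
      intro hb0
      have ha0 : a ≠ 0 := by
        intro ha0
        refine hv (funext fun ai => ?_)
        obtain ⟨l, i⟩ := ai
        fin_cases l
        · exact congrFun ha0 i
        · exact congrFun hb0 i
      refine hGi ⟨a, ha0, ?_⟩
      rw [hb0, zero_dotProduct, mul_zero, sub_zero] at h0
      exact h0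
    have hGb : b ⬝ᵥ G *ᵥ b ≠ 0 := fun h => hGi ⟨b, hb0, h⟩
    by_cases hab : ∀ c : E, a ≠ c • b
    · obtain ⟨d, hd, hfact, hq⟩ := exists_isotropic_quadraticExtension hG hGi hb0 hab
      -- From `G(a) = x G(b)` and the definition of `d` one gets `x = (G(a, b)² - d) / G(b)²`, a
      -- norm with `τ = 1 / G(b)`.
      have h3 := hasIsotropicFrame_twist_of_norm h2 (s := (a ⬝ᵥ G *ᵥ b) / (b ⬝ᵥ G *ᵥ b))
        (inv_ne_zero hGb) hS
        (h (QuadraticAlgebra E d 0) (algebraMap E (QuadraticAlgebra E d 0)) hq)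
      convert h3 using 2
      rw [hd]
      field_simp
      linear_combination -(b ⬝ᵥ G *ᵥ b) * h0
    -- If `a = c b`, then `x = c²` and `a`, `b` span no plane; as the dimension is at least two, any
    -- `a'` not proportional to `b` supplies the quadratic extension.
    · push Not at hab
      obtain ⟨c, hc⟩ := hab
      obtain ⟨a', ha'⟩ := exists_ne_smul hι hb0
      obtain ⟨d, -, hfact, hq⟩ := exists_isotropic_quadraticExtension hG hGi hb0 ha'
      have hd : 1 - d ≠ 0 := by
        intro hd
        refine hfact.out 1 ?_
        linear_combination hd
      have hxc : x = c ^ 2 := by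
        rw [hc] at h0
        simp only [mulVec_smul, dotProduct_smul, smul_dotProduct, smul_eq_mul] at h0
        refine mul_right_cancel₀ hGb ?_
        linear_combination -h0
      have hc0 : c ≠ 0 := by
        rintro rfl
        exact hx (by simpa using hxc)
      -- The obvious representation of `c²` as a norm has `τ = 0`. Multiplying `c` by the norm-one
      -- element `(1 + ω) / (1 - ω)` makes `τ` nonzero.
      have h3 := hasIsotropicFrame_twist_of_norm h2 (s := c * (1 + d) / (1 - d))
        (τ := 2 * c / (1 - d)) (div_ne_zero (mul_ne_zero h2 hc0) hd) hS
        (h (QuadraticAlgebra E d 0) (algebraMap E (QuadraticAlgebra E d 0)) hq)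
      convert h3 using 2
      rw [hxc]
      field_simp
      ring

/-- Let `α`, `β` be the reductions modulo `x` of the two components of an integral frame. The
relation `S(a₀) = x S(a₁)` makes `range α` totally isotropic, and on `ker α` a second division by
`x` makes `β` isotropic. The left inverse makes `β` injective on `ker α`, so by rank-nullity one of
the two spaces has dimension at least `m / 2`. -/
theorem exists_hasIsotropicFrame_of_twist_laurentSeries {M : Type*} [Field M] (h2 : (2 : M) ≠ 0)
    {S : Matrix κ κ M} (hS : S.IsSymm) {m : ℕ}
    (h : HasIsotropicFrame (twist (HahnSeries.single 1 1 : M⸨X⸩)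
      (S.map (algebraMap M M⸨X⸩))) m) :
    ∃ k, m ≤ 2 * k ∧ HasIsotropicFrame S k := by
  have h1 : HasIsotropicFrame ((twist (PowerSeries.X (R := M))
      (S.map (PowerSeries.C (R := M)))).map (algebraMap (PowerSeries M) M⸨X⸩)) m := by
    rw [twist_map, Matrix.map_map]
    convert h using 2
    · exact PowerSeries.coe_X
    · congr 1
  obtain ⟨A, B, hA, hB⟩ := hasIsotropicFrame_of_fractionRing h1
  let γ := PowerSeries.constantCoeff (R := M)
  let α : (Fin m → M) →ₗ[M] (κ → M) := (Matrix.of fun i j => γ (A (0, i) j)).mulVecLin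
  let β : (Fin m → M) →ₗ[M] (κ → M) := (Matrix.of fun i j => γ (A (1, i) j)).mulVecLin
  let a (c : Fin m → M) (l : Fin 2) (i : κ) : PowerSeries M := (A *ᵥ (PowerSeries.C ∘ c)) (l, i)
  have haα : ∀ c, γ ∘ a c 0 = α c := by
    intro c
    ext i
    simp [a, α, mulVec, dotProduct, γ]
  have haβ : ∀ c, γ ∘ a c 1 = β c := by
    intro c
    ext i
    simp [a, β, mulVec, dotProduct, γ]
  have hγS : (S.map (PowerSeries.C (R := M))).map γ = S := by
    ext i j
    simp [γ]
  have hrel : ∀ c, a c 0 ⬝ᵥ (S.map PowerSeries.C) *ᵥ a c 0 =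
      PowerSeries.X * (a c 1 ⬝ᵥ (S.map PowerSeries.C) *ᵥ a c 1) := by
    intro c
    have := mulVec_dotProduct_mulVec_eq_zero hA (PowerSeries.C ∘ c) (PowerSeries.C ∘ c)
    rw [dotProduct_twist_mulVec] at this
    exact sub_eq_zero.1 this
  have hα : ∀ c, α c ⬝ᵥ S *ᵥ α c = 0 := by
    intro c
    have := congrArg γ (hrel c)
    rwa [← map_dotProduct_mulVec, haα, hγS, map_mul, PowerSeries.constantCoeff_X, zero_mul] at this
  have hβ : ∀ c, α c = 0 → β c ⬝ᵥ S *ᵥ β c = 0 := by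
    intro c hc
    have hdvd : ∀ i, PowerSeries.X ∣ a c 0 i := fun i => by
      rw [PowerSeries.X_dvd_iff]
      exact congrFun ((haα c).trans hc) i
    choose a' ha' using hdvd
    have h3 := hrel c
    rw [show a c 0 = (PowerSeries.X (R := M)) • a' from funext ha', mulVec_smul, dotProduct_smul,
      smul_dotProduct, smul_eq_mul, smul_eq_mul] at h3
    have h4 := mul_left_cancel₀ PowerSeries.X_ne_zero h3
    have := congrArg γ h4
    rw [← map_dotProduct_mulVec, haβ, hγS, map_mul, PowerSeries.constantCoeff_X, zero_mul] at this
    exact this.symm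
  have hinj : ∀ c, α c = 0 → β c = 0 → c = 0 := by
    intro c hc1 hc2
    have h3 : γ ∘ (A *ᵥ (PowerSeries.C ∘ c)) = 0 := by
      ext ⟨l, i⟩
      fin_cases l
      · exact congrFun ((haα c).trans hc1) i
      · exact congrFun ((haβ c).trans hc2) i
    have h4 : γ ∘ (B *ᵥ (A *ᵥ (PowerSeries.C ∘ c))) = B.map γ *ᵥ (γ ∘ (A *ᵥ (PowerSeries.C ∘ c))) :=
      funext fun i => RingHom.map_mulVec γ B _ i
    rw [h3, mulVec_mulVec, hB, one_mulVec, mulVec_zero] at h4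
    ext i
    simpa [γ] using congrFun h4 i
  have hdim := α.finrank_range_add_finrank_ker
  rw [Module.finrank_fin_fun] at hdim
  by_cases hle : m ≤ 2 * Module.finrank M (LinearMap.range α)
  · refine ⟨_, hle, hasIsotropicFrame_of_linearMap h2 hS (LinearMap.range α).subtype
      (Submodule.subtype_injective _) ?_ le_rfl⟩
    rintro ⟨_, c, rfl⟩
    exact hα c
  · refine ⟨Module.finrank M (LinearMap.ker α), by omega, hasIsotropicFrame_of_linearMap h2 hS
      (β ∘ₗ (LinearMap.ker α).subtype) ?_ (fun c => hβ c c.2) le_rfl⟩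
    rw [← LinearMap.ker_eq_bot, eq_bot_iff]
    intro c hc
    rw [Submodule.mem_bot]
    exact Subtype.ext (hinj c c.2 hc)

/-- The coefficientwise extension of a field homomorphism to Laurent series. -/
def laurentMap {F M : Type*} [Field F] [Field M] (ρ : F →+* M) : F⸨X⸩ →+* M⸨X⸩ :=
  IsFractionRing.map (A := PowerSeries F) (B := PowerSeries M) (j := PowerSeries.map ρ)
    (PowerSeries.map_injective ρ ρ.injective)

theorem laurentMap_coe {F M : Type*} [Field F] [Field M] (ρ : F →+* M) (f : PowerSeries F) :
    laurentMap ρ (algebraMap (PowerSeries F) F⸨X⸩ f) =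
      algebraMap (PowerSeries M) M⸨X⸩ (PowerSeries.map ρ f) := by
  rw [laurentMap, IsFractionRing.map, IsLocalization.map_eq]

theorem algebraMap_powerSeries_C {F : Type*} [Field F] (a : F) :
    algebraMap (PowerSeries F) F⸨X⸩ (PowerSeries.C a) = algebraMap F F⸨X⸩ a := by
  change ((PowerSeries.C a : PowerSeries F) : F⸨X⸩) = algebraMap F F⸨X⸩ a
  rw [PowerSeries.coe_C, LaurentSeries.algebraMap_apply]

theorem algebraMap_powerSeries_X {F : Type*} [Field F] :
    algebraMap (PowerSeries F) F⸨X⸩ PowerSeries.X = HahnSeries.single 1 1 :=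
  PowerSeries.coe_X

theorem laurentMap_comp_algebraMap {F M : Type*} [Field F] [Field M] (ρ : F →+* M) :
    (laurentMap ρ).comp (algebraMap F F⸨X⸩) = (algebraMap M M⸨X⸩).comp ρ := by
  ext1 a
  rw [RingHom.comp_apply, RingHom.comp_apply, ← algebraMap_powerSeries_C, laurentMap_coe,
    PowerSeries.map_C, algebraMap_powerSeries_C]

theorem laurentMap_single {F M : Type*} [Field F] [Field M] (ρ : F →+* M) :
    laurentMap ρ (HahnSeries.single 1 1) = HahnSeries.single 1 1 := by
  rw [← algebraMap_powerSeries_X, laurentMap_coe, PowerSeries.map_X, algebraMap_powerSeries_X]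

variable {F : Type u} [Field F] {G : Matrix ι ι F} {S : Matrix κ κ F}

theorem IsotropyForces.map {k : ℕ} (h : IsotropyForces G S k) {E : Type u} [Field E]
    (ρ : F →+* E) : IsotropyForces (G.map ρ) (S.map ρ) k := by
  intro M _ σ hσ
  rw [Matrix.map_map, ← RingHom.coe_comp] at hσ ⊢
  exact h M _ hσ

theorem IsotropyForces.twist (h2 : (2 : F) ≠ 0) (hG : G.IsSymm) (hι : 2 ≤ Fintype.card ι)
    (hS : S.IsSymm) {k : ℕ} (h : IsotropyForces G S k) :
    IsotropyForces (twist (HahnSeries.single 1 1 : F⸨X⸩) (G.map (algebraMap F F⸨X⸩)))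
      (QuadForm.twist (HahnSeries.single 1 1 : F⸨X⸩) (S.map (algebraMap F F⸨X⸩))) (2 * k) := by
  intro E _ ρ hρ
  have h2' : (2 : E) ≠ 0 := by
    rw [← map_ofNat (ρ.comp (algebraMap F F⸨X⸩)) 2]
    exact (map_ne_zero _).2 h2
  rw [twist_map] at hρ ⊢
  refine ((h.map (algebraMap F F⸨X⸩)).map ρ).hasIsotropicFrame_twist h2' ((hG.map _).map _) hι
    ((hS.map _).map _) ?_ hρ
  exact (map_ne_zero ρ).2 (HahnSeries.single_ne_zero one_ne_zero)

theorem IsotropyForces.exists_of_twist (h2 : (2 : F) ≠ 0) (hS : S.IsSymm) {m : ℕ}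
    (h : IsotropyForces (QuadForm.twist (HahnSeries.single 1 1 : F⸨X⸩)
        (G.map (algebraMap F F⸨X⸩)))
      (QuadForm.twist (HahnSeries.single 1 1 : F⸨X⸩) (S.map (algebraMap F F⸨X⸩))) m) :
    ∃ k, m ≤ 2 * k ∧ IsotropyForces G S k := by
  -- The dimension found below depends on `M`, but it is always at least `m / 2` rounded up, so this
  -- one value serves every `M`.
  refine ⟨(m + 1) / 2, by omega, fun M _ ρ hρ => ?_⟩
  have h2' : (2 : M) ≠ 0 := by
    rw [← map_ofNat ρ 2]
    exact (map_ne_zero _).2 h2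
  have hiso : IsIsotropic ((QuadForm.twist (HahnSeries.single 1 1 : F⸨X⸩)
      (G.map (algebraMap F F⸨X⸩))).map (laurentMap ρ)) := by
    rw [twist_map, Matrix.map_map, ← RingHom.coe_comp, laurentMap_comp_algebraMap,
      RingHom.coe_comp, ← Matrix.map_map]
    obtain ⟨v, hv, h0⟩ := hρ.map (algebraMap M M⸨X⸩)
    refine ⟨fun ai => ![v ai.2, 0] ai.1, fun hz => hv ?_, ?_⟩
    · ext1 i
      exact congrFun hz (0, i)
    · rw [dotProduct_twist_mulVec]
      have c1 : (fun i => (fun ai : Fin 2 × ι => ![v ai.2, 0] ai.1) (1, i)) = 0 := rfl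
      rw [c1, zero_dotProduct, mul_zero, sub_zero]
      exact h0
  have h3 := h _ _ hiso
  rw [twist_map, Matrix.map_map, ← RingHom.coe_comp, laurentMap_comp_algebraMap,
    RingHom.coe_comp, ← Matrix.map_map, laurentMap_single] at h3
  obtain ⟨k, hk, hk'⟩ := exists_hasIsotropicFrame_of_twist_laurentSeries h2' (hS.map ρ) h3
  exact hk'.mono h2' (hS.map ρ) (by omega)

end Doubling

/-! ### Induction over the variables of the generic Pfister form -/

section Pfister

variable {ι κ : Type*} [Fintype ι] [Fintype κ]

theorem HasIsotropicFrame.submatrix {R : Type*} [CommRing R] {S : Matrix κ κ R} {k : ℕ}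
    (h : HasIsotropicFrame S k) (e : ι ≃ κ) : HasIsotropicFrame (S.submatrix e e) k := by
  obtain ⟨A, B, h1, h2⟩ := h
  refine ⟨A.submatrix e id, B.submatrix id e, ?_, ?_⟩
  · rw [transpose_submatrix, submatrix_mul_equiv, submatrix_mul_equiv, h1]
    rfl
  · rw [submatrix_mul_equiv, h2]
    rfl

theorem IsIsotropic.of_submatrix {R : Type*} [CommRing R] {S : Matrix κ κ R} (e : ι ≃ κ)
    (h : IsIsotropic (S.submatrix e e)) : IsIsotropic S := by
  obtain ⟨v, hv, h0⟩ := h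
  refine ⟨v ∘ e.symm, fun hz => hv ?_, ?_⟩
  · ext i
    simpa using congrFun hz (e i)
  · rwa [submatrix_mulVec_equiv, ← comp_equiv_symm_dotProduct] at h0

theorem IsotropyForces.submatrix {ι' κ' : Type*} [Fintype ι'] [Fintype κ'] {F : Type u} [Field F]
    {G : Matrix ι ι F} {S : Matrix κ κ F} {k : ℕ} (h : IsotropyForces G S k) (e : ι' ≃ ι)
    (f : κ' ≃ κ) : IsotropyForces (G.submatrix e e) (S.submatrix f f) k :=
  fun M _ ρ hρ => (h M ρ (IsIsotropic.of_submatrix e hρ)).submatrix f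

theorem IsotropyForces.of_submatrix {ι' κ' : Type*} [Fintype ι'] [Fintype κ'] {F : Type u}
    [Field F] {G : Matrix ι ι F} {S : Matrix κ κ F} {k : ℕ} (e : ι' ≃ ι) (f : κ' ≃ κ)
    (h : IsotropyForces (G.submatrix e e) (S.submatrix f f) k) : IsotropyForces G S k := by
  simpa using h.submatrix e.symm f.symm

/-- The index set of the standard basis of an `n`-fold Pfister form. -/
def PfisterIndex : ℕ → Type
  | 0 => Unit
  | n + 1 => Fin 2 × PfisterIndex n

instance PfisterIndex.instFintype : (n : ℕ) → Fintype (PfisterIndex n)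
  | 0 => inferInstanceAs (Fintype Unit)
  | n + 1 =>
    haveI := PfisterIndex.instFintype n
    inferInstanceAs (Fintype (Fin 2 × PfisterIndex n))

instance PfisterIndex.instDecidableEq : (n : ℕ) → DecidableEq (PfisterIndex n)
  | 0 => inferInstanceAs (DecidableEq Unit)
  | n + 1 =>
    haveI := PfisterIndex.instDecidableEq n
    inferInstanceAs (DecidableEq (Fin 2 × PfisterIndex n))

theorem card_pfisterIndex (n : ℕ) : Fintype.card (PfisterIndex n) = 2 ^ n := by
  induction n with
  | zero => rfl
  | succ n ih =>
    have : Fintype.card (PfisterIndex (n + 1)) = Fintype.card (Fin 2 × PfisterIndex n) := rfl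
    rw [this, Fintype.card_prod, ih, Fintype.card_fin, pow_succ, mul_comm]

/-- The matrix of the Pfister form `⟨1, -a_1⟩ ⊗ … ⊗ ⟨1, -a_n⟩`. -/
def pfisterMatrix {R : Type*} [CommRing R] :
    (n : ℕ) → (Fin n → R) → Matrix (PfisterIndex n) (PfisterIndex n) R
  | 0, _ => (1 : Matrix Unit Unit R)
  | n + 1, a => twist (a 0) (pfisterMatrix n (Fin.tail a))

theorem det_pfisterMatrix_ne_zero {K : Type*} [Field K] (n : ℕ) (a : Fin n → K)
    (ha : ∀ i, a i ≠ 0) : (pfisterMatrix n a).det ≠ 0 := by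
  induction n with
  | zero =>
    change (1 : Matrix Unit Unit K).det ≠ 0
    simp
  | succ n ih =>
    have h := ih (Fin.tail a) fun i => ha i.succ
    change (diagonal ![1, -(a 0)] ⊗ₖ pfisterMatrix n (Fin.tail a)).det ≠ 0
    rw [det_kronecker, det_diagonal]
    refine mul_ne_zero (pow_ne_zero _ ?_) (pow_ne_zero _ h)
    simp [Fin.prod_univ_two, ha 0]

variable {K : Type u} [Field K] [Invertible (2 : K)]

omit [Fintype ι] [Fintype κ] in
theorem gram_tmul {V : Type v} [AddCommGroup V] [Module K V] {W : Type w} [AddCommGroup W]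
    [Module K W] (Q : QuadraticForm K V) (Q' : QuadraticForm K W) (b : Module.Basis ι K V)
    (b' : Module.Basis κ K W) :
    gram (QuadraticForm.tmul Q Q') (b.tensorProduct b') = gram Q b ⊗ₖ gram Q' b' := by
  ext ⟨i, j⟩ ⟨i', j'⟩
  simp [gram, QuadraticForm.associated_tmul, mul_comm]

omit [Fintype ι] in
theorem gram_baseChange {F : Type u} [Field F] [Invertible (2 : F)] [Algebra F K] {V : Type v}
    [AddCommGroup V] [Module F V] (Q : QuadraticForm F V) (b : Module.Basis ι F V) :
    gram (Q.baseChange K) (b.baseChange K) = (gram Q b).map (algebraMap F K) := by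
  ext i j
  simp [gram, QuadraticForm.associated_baseChange, Algebra.algebraMap_eq_smul_one]

theorem gram_binary (a : K) :
    gram (binary K 1 (-a)) (Pi.basisFun K (Fin 2)) = diagonal ![1, -a] := by
  ext i j
  simp only [gram, Matrix.of_apply, QuadraticMap.associated_apply, binary, Pi.basisFun_apply,
    QuadraticMap.weightedSumSquares_apply, Fin.sum_univ_two]
  have h2 := Invertible.ne_zero (2 : K)
  fin_cases i <;> fin_cases j <;> simp <;> field_simp <;> ring

theorem gram_sq : gram (QuadraticMap.sq (R := K)) (Module.Basis.singleton Unit K) = 1 := by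
  ext i j
  rw [gram, Matrix.of_apply, Module.Basis.singleton_apply, QuadraticMap.associated_eq_self_apply,
    Subsingleton.elim i j, one_apply_eq]
  simp

theorem exists_pfister_basis (n : ℕ) (a : Fin n → K) :
    ∃ b : Module.Basis (PfisterIndex n) K (pfister n a),
      gram (pfister n a).form b = pfisterMatrix n a := by
  induction n with
  | zero =>
    refine ⟨(Module.Basis.singleton Unit K : Module.Basis Unit K K), ?_⟩
    exact gram_sq
  | succ n ih =>
    obtain ⟨b, hb⟩ := ih (Fin.tail a)
    refine ⟨((Pi.basisFun K (Fin 2)).tensorProduct b :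
      Module.Basis (Fin 2 × PfisterIndex n) K _), ?_⟩
    refine (gram_tmul (binary K 1 (-(a 0))) (pfister n (Fin.tail a)).form _ b).trans ?_
    rw [hb, gram_binary]
    rfl

theorem var_ne_zero (n : ℕ) (F : Type u) [Field F] (i : Fin n) :
    IteratedLaurent.var n F i ≠ 0 := by
  induction n generalizing F with
  | zero => exact i.elim0
  | succ n ih =>
    refine Fin.cases ?_ (fun j => ?_) i
    · change algebraMap F⸨X⸩ (IteratedLaurent n F⸨X⸩) (HahnSeries.single 1 1) ≠ 0
      rw [Ne, map_eq_zero]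
      exact HahnSeries.single_ne_zero one_ne_zero
    · exact ih F⸨X⸩ j

/-- Interchange of the factors of a Pfister form. -/
def pfisterIndexSwap (n : ℕ) (ι : Type*) :
    PfisterIndex (n + 1) × ι ≃ PfisterIndex n × (Fin 2 × ι) where
  toFun x := (x.1.2, (x.1.1, x.2))
  invFun x := ((x.2.1, x.1), x.2.2)
  left_inv _ := rfl
  right_inv _ := rfl

/-- The matrix of the tensor product of the generic `n`-fold Pfister form with the form with
matrix `G`. -/
def pfisterTensor (n : ℕ) {F : Type u} [Field F] (G : Matrix ι ι F) :
    Matrix (PfisterIndex n × ι) (PfisterIndex n × ι) (IteratedLaurent n F) :=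
  pfisterMatrix n (IteratedLaurent.var n F) ⊗ₖ G.map (algebraMap F (IteratedLaurent n F))

-- The first variable already lies in `F((x_1))`, so its binary factor can be absorbed into `G`,
-- leaving an `n`-fold product over the base field `F((x_1))`. This drives both inductions, which
-- therefore generalize `F` and `G`.
omit [Fintype ι] in
theorem pfisterTensor_succ (n : ℕ) {F : Type u} [Field F] (G : Matrix ι ι F) :
    pfisterTensor (n + 1) G = (pfisterTensor n (twist (HahnSeries.single 1 1 : F⸨X⸩)
      (G.map (algebraMap F F⸨X⸩)))).submatrix (pfisterIndexSwap n ι) (pfisterIndexSwap n ι) := by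
  ext ⟨⟨i, j⟩, l⟩ ⟨⟨i', j'⟩, l'⟩
  rw [submatrix_apply]
  change (diagonal ![(1 : IteratedLaurent n F⸨X⸩), -algebraMap F⸨X⸩ (IteratedLaurent n F⸨X⸩)
      (HahnSeries.single 1 1)] i i' * pfisterMatrix n (IteratedLaurent.var n F⸨X⸩) j j') *
      algebraMap F⸨X⸩ (IteratedLaurent n F⸨X⸩) (algebraMap F F⸨X⸩ (G l l')) =
    pfisterMatrix n (IteratedLaurent.var n F⸨X⸩) j j' * algebraMap F⸨X⸩ (IteratedLaurent n F⸨X⸩)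
      (diagonal ![(1 : F⸨X⸩), -HahnSeries.single 1 1] i i' * algebraMap F F⸨X⸩ (G l l'))
  rw [map_mul]
  fin_cases i <;> fin_cases i' <;> simp <;> ring

theorem two_ne_zero_laurentSeries {F : Type u} [Field F] (h2 : (2 : F) ≠ 0) : (2 : F⸨X⸩) ≠ 0 := by
  rw [← map_ofNat (algebraMap F F⸨X⸩) 2]
  exact (map_ne_zero _).2 h2

omit [Fintype ι] in
theorem pfisterTensor_zero {F : Type u} [Field F] (G : Matrix ι ι F) :
    pfisterTensor 0 G = G.submatrix (Equiv.punitProd ι) (Equiv.punitProd ι) := by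
  ext ⟨i, l⟩ ⟨i', l'⟩
  exact one_mul (G l l')

theorem IsotropyForces.pfisterTensor {F : Type u} [Field F] {G : Matrix ι ι F} {S : Matrix κ κ F}
    (h2 : (2 : F) ≠ 0) (hG : G.IsSymm) (hι : 2 ≤ Fintype.card ι)
    (hS : S.IsSymm) {k : ℕ} (h : IsotropyForces G S k) (n : ℕ) :
    IsotropyForces (QuadForm.pfisterTensor n G) (QuadForm.pfisterTensor n S) (2 ^ n * k) := by
  induction n generalizing F ι κ k with
  | zero =>
    rw [pfisterTensor_zero, pfisterTensor_zero, pow_zero, one_mul]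
    exact h.submatrix _ _
  | succ n ih =>
    rw [pfisterTensor_succ, pfisterTensor_succ, pow_succ, mul_assoc]
    exact (ih (two_ne_zero_laurentSeries h2) (twist_isSymm _ (hG.map _))
      (by rw [Fintype.card_prod, Fintype.card_fin]; omega) (twist_isSymm _ (hS.map _))
      (h.twist h2 hG hι hS)).submatrix _ _

theorem IsotropyForces.exists_of_pfisterTensor {F : Type u} [Field F] {G : Matrix ι ι F}
    {S : Matrix κ κ F} (h2 : (2 : F) ≠ 0)
    (hS : S.IsSymm) (n : ℕ) {m : ℕ}
    (h : IsotropyForces (QuadForm.pfisterTensor n G) (QuadForm.pfisterTensor n S) m) :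
    ∃ k, m ≤ 2 ^ n * k ∧ IsotropyForces G S k := by
  induction n generalizing F ι κ with
  | zero =>
    refine ⟨m, by simp, ?_⟩
    rw [pfisterTensor_zero, pfisterTensor_zero] at h
    exact IsotropyForces.of_submatrix (F := F) _ _ h
  | succ n ih =>
    rw [pfisterTensor_succ, pfisterTensor_succ] at h
    have h' := IsotropyForces.of_submatrix _ _ h
    obtain ⟨j, hj, hj'⟩ := ih (two_ne_zero_laurentSeries h2) (twist_isSymm _ (hS.map _)) h'
    obtain ⟨k, hk, hk'⟩ := hj'.exists_of_twist h2 hS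
    refine ⟨k, hj.trans ?_, hk'⟩
    rw [pow_succ, mul_assoc]
    exact Nat.mul_le_mul_left _ hk

/-- Translation between the Witt index over the function field and forcing, in arbitrary bases, so
that the tensor product basis can be used for `π ⊗ p` and `π ⊗ q`. -/
theorem le_wittIndex_functionField_iff {F : Type u} [Field F] [Invertible (2 : F)]
    {V : Type v} [AddCommGroup V] [Module F V] [FiniteDimensional F V]
    {W : Type w} [AddCommGroup W] [Module F W]
    (p : QuadraticForm F V) (q : QuadraticForm F W)
    (hp : p.Nondegenerate) (hq : q.Nondegenerate) (hd : 2 ≤ Module.finrank F V)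
    (b : Module.Basis ι F V) (b' : Module.Basis κ F W) (k : ℕ) :
    k ≤ wittIndex (q.baseChange (FunctionField p)) ↔ IsotropyForces (gram p b) (gram q b') k := by
  classical
  have : Invertible (2 : FunctionField p) :=
    (Invertible.map (algebraMap F (FunctionField p)) 2).copy 2 (map_ofNat _ _).symm
  have hgram := gram_baseChange (K := FunctionField p) q b'
  have hnd : (q.baseChange (FunctionField p)).Nondegenerate := by
    rw [nondegenerate_iff_det_gram_ne_zero _ (b'.baseChange (FunctionField p)), hgram,
      ← RingHom.mapMatrix_apply, ← RingHom.map_det]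
    exact (map_ne_zero _).2 ((nondegenerate_iff_det_gram_ne_zero q b').1 hq)
  rw [le_wittIndex_iff _ hnd (b'.baseChange (FunctionField p)), hgram,
    ← isotropyForces_iff p hp hd]
  exact ⟨fun h => h.of_basis p _ b, fun h => h.of_basis p b _⟩

omit [Fintype ι] in
theorem gram_pfister_tmul {F : Type u} [Field F] [Invertible (2 : F)] (n : ℕ)
    {b : Module.Basis (PfisterIndex n) (IteratedLaurent n F)
      (pfister n (IteratedLaurent.var n F))}
    (hb : gram (pfister n (IteratedLaurent.var n F)).form b =
      pfisterMatrix n (IteratedLaurent.var n F))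
    {V : Type v} [AddCommGroup V] [Module F V] (r : QuadraticForm F V)
    (c : Module.Basis ι F V) :
    gram (QuadraticForm.tmul (pfister n (IteratedLaurent.var n F)).form
      (r.baseChange (IteratedLaurent n F)))
        (b.tensorProduct (c.baseChange (IteratedLaurent n F))) = pfisterTensor n (gram r c) := by
  rw [gram_tmul, hb, gram_baseChange, pfisterTensor]

theorem det_pfisterTensor_ne_zero [DecidableEq ι] {F : Type u} [Field F] (n : ℕ)
    {G : Matrix ι ι F} (hG : G.det ≠ 0) : (pfisterTensor n G).det ≠ 0 := by
  rw [pfisterTensor, det_kronecker, ← RingHom.mapMatrix_apply, ← RingHom.map_det]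
  exact mul_ne_zero (pow_ne_zero _ (det_pfisterMatrix_ne_zero n _ (var_ne_zero n F)))
    (pow_ne_zero _ ((map_ne_zero _).2 hG))

end Pfister
end QuadForm

end

theorem mainTheorem9 {F : Type u} [Field F] [Invertible (2 : F)]
    {V : Type v} [AddCommGroup V] [Module F V] [FiniteDimensional F V]
    {W : Type w} [AddCommGroup W] [Module F W] [FiniteDimensional F W]
    (p : QuadraticForm F V) (q : QuadraticForm F W)
    (hp : p.Nondegenerate) (hq : q.Nondegenerate)
    (hpdim : 2 ≤ Module.finrank F V) (hqdim : 2 ≤ Module.finrank F W) (n : ℕ) :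
    let K := QuadForm.IteratedLaurent n F
    let π := QuadForm.pfister n (QuadForm.IteratedLaurent.var n F)
    let πp := QuadraticForm.tmul π.form (p.baseChange K)
    let πq := QuadraticForm.tmul π.form (q.baseChange K)
    QuadForm.wittIndex (πq.baseChange (QuadForm.FunctionField πp)) =
      Module.finrank K π * QuadForm.wittIndex (q.baseChange (QuadForm.FunctionField p)) := by
  classical
  intro K π πp πq
  obtain ⟨b, hb⟩ := QuadForm.exists_pfister_basis n (QuadForm.IteratedLaurent.var n F)
  let c := Module.finBasis F V
  let c' := Module.finBasis F W
  have hgp := QuadForm.gram_pfister_tmul n hb p c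
  have hgq := QuadForm.gram_pfister_tmul n hb q c'
  have hπp : πp.Nondegenerate := by
    rw [QuadForm.nondegenerate_iff_det_gram_ne_zero πp (b.tensorProduct (c.baseChange K)), hgp]
    exact QuadForm.det_pfisterTensor_ne_zero n
      ((QuadForm.nondegenerate_iff_det_gram_ne_zero p c).1 hp)
  have hπq : πq.Nondegenerate := by
    rw [QuadForm.nondegenerate_iff_det_gram_ne_zero πq (b.tensorProduct (c'.baseChange K)), hgq]
    exact QuadForm.det_pfisterTensor_ne_zero n
      ((QuadForm.nondegenerate_iff_det_gram_ne_zero q c').1 hq)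
  have hrank : Module.finrank K π = 2 ^ n := by
    rw [Module.finrank_eq_card_basis b, QuadForm.card_pfisterIndex]
  have hdim : 2 ≤ Module.finrank K (π ⊗[K] (K ⊗[F] V)) := by
    rw [Module.finrank_tensorProduct, hrank, Module.finrank_baseChange]
    exact hpdim.trans (Nat.le_mul_of_pos_left _ (by positivity))
  have h2 : (2 : F) ≠ 0 := Invertible.ne_zero 2
  have hiff (k : ℕ) := QuadForm.le_wittIndex_functionField_iff p q hp hq hpdim c c' k
  have hiff' (k : ℕ) := QuadForm.le_wittIndex_functionField_iff πp πq hπp hπq hdim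
    (b.tensorProduct (c.baseChange K)) (b.tensorProduct (c'.baseChange K)) k
  rw [hgp, hgq] at hiff'
  have hS := QuadForm.gram_isSymm q c'
  rw [hrank]
  apply le_antisymm
  -- The index over `K(π ⊗ p)` is itself a forced dimension; it descends to some `k` forced over
  -- `F`, and `k` is at most `i(q_{F(p)})`.
  · obtain ⟨k, hk, hk'⟩ := ((hiff' _).1 le_rfl).exists_of_pfisterTensor h2 hS n
    exact hk.trans (Nat.mul_le_mul_left _ ((hiff k).2 hk'))
  · rw [hiff']
    exact ((hiff _).1 le_rfl).pfisterTensor h2 (QuadForm.gram_isSymm p c) (by simpa using hpdim)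
      hS n
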